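/- **Setting.** Let $1\le d\le N$ be integers (in particular $N\ge 1$), $n=\lceil\log_2 N\rceil$, and label rows and columns by $0,\dots,N-1$. A matrix $A\in\mathbb C^{N\times N}$ is *$d$-sparse* if each row and each column has at most $d$ non-zero entries; a Hermitian $A$ is *diagonally dominant* if $\sum_{j\ne i}|A_{ij}|\le |A_{ii}|$ for all $i$. A *sparse-matrix oracle* for $A$ is a pair of reversible operations with $$\mathcal P^{pos}_A:|i,\nu\rangle\mapsto|i,j(i,\nu)\rangle,\qquad \mathcal P^{val}_A:|i,j,z\rangle\mapsto|i,j,z+A_{ij}\rangle\qquad(0\le i,j<N,\ 0\le\nu<d),$$ where for each $i$ the list $j(i,0),\dots,j(i,d-1)$ of elements of $\{0,\dots,N-1\}$ contains the positions of all non-zero entries of row $i$; nothing is assumed on other inputs. *Cost model.* Memory consists of $n$-qubit index registers, single qubits, and registers holding exact complex numbers. The query complexity of a circuit is the number of calls to $\mathcal P^{pos}_A,\mathcal P^{val}_A$ and their inverses; its gate complexity is the number of all other gates, where each of the following is one gate: an exact single-qubit unitary; a controlled-not or Toffoli gate; an exact controlled rotation or phase rotation of a qubit by an angle stored in a number register;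 a reversible elementary operation on $O(1)$ index registers (adding a constant, addition, controlled addition, swap, comparison); a reversible elementary arithmetic operation on $O(1)$ number registers (adding a rational constant or a bit, copy, $+,-,\times,\div$, conjugate, modulus, square root, $\arccos$, argument). (So single-qubit rotations are exact and arithmetic uses a constant number of digits, i.e. unit cost, without rounding.) A unitary $U$ on $n+a$ qubits is an $(\alpha,a,\varepsilon)$*-block-encoding* of an $n$-qubit operator $M$ if $\|M-\alpha(\langle 0^a|\otimes I)U(|0^a\rangle\otimes I)\|\le\varepsilon$, and *normalised* if $\alpha=1$; a circuit implementing $U$ may use further ancillas that are zero before and after. **Proposition.** There is an absolute constant $C$ such that for all $1\le d\le N$ there are circuits $c_L,c_R,c$, depending only on $N$ and $d$, each of query complexity at most $Cd$ and gate complexity at most $Cd$, with the following property. Let $A\in\mathbb C^{N\times N}$ be positive definite, $d$-sparse and diagonally dominant with $A_{ii}\le 1$ for all $i$. When run with any sparse-matrix oracle for $A$, the circuits $c_L$, $c_R$, $c$ implement unitaries $U_L$, $U_R$ and $U_L^\dagger U_R$ on $n+(n+2)$ qubits such that 1. for all $i,j\in\{0,\dots,N-1\}$, $U_L:|0^{n+2}\rangle|i\rangle\mapsto|i\rangle|\psi_i^*\rangle$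 and $U_R:|0^{n+2}\rangle|j\rangle\mapsto|\phi_j\rangle|j\rangle$, where (principal square roots; $*$ is complex conjugation; $|\bot\rangle$ is an additional basis state orthogonal to all $|l\rangle$, $l<N$, of an $(n+1)$-qubit register) $$|\psi_i\rangle=\sum_{l:\,A_{il}\neq0}\sqrt{\delta_{il}-A_{il}}\,|l\rangle+\sqrt{r_i}\,|\bot\rangle,\quad |\phi_j\rangle=\sum_{k:\,A_{jk}\neq0}\sqrt{\delta_{jk}-A_{jk}^*}\,|k\rangle+\sqrt{r_j}\,|\bot\rangle,\quad r_i=A_{ii}-\sum_{l\ne i}|A_{il}|;$$ 2. $U_L^\dagger U_R$ is a $(1,n+2,0)$-block-encoding, i.e. an exact normalised block-encoding, of $B=I-A$ (padded with zeroes to an $n$-qubit operator if $N<2^n$). -/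

import Mathlib

open scoped Matrix ComplexOrder

noncomputable section

namespace PDQLS

/-! ### The matrices -/

/-- At most `d` non-zero entries in each row and each column. -/
def IsSparse {N : ℕ} (d : ℕ) (A : Matrix (Fin N) (Fin N) ℂ) : Prop :=
  (∀ i, {j | A i j ≠ 0}.ncard ≤ d) ∧ (∀ j, {i | A i j ≠ 0}.ncard ≤ d)

/-- Diagonal dominance (of a Hermitian matrix), not necessarily strict. -/
def IsDiagDominant {N : ℕ} (A : Matrix (Fin N) (Fin N) ℂ) : Prop :=
  ∀ i, ∑ j ∈ Finset.univ.erase i, ‖A i j‖ ≤ ‖A i i‖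

/-! ### Words, memory, oracles

An `n`-qubit register has the computational basis `Fin (2 ^ n)`, the integers being written in
binary.  The row/column label `i ∈ {0, …, N - 1}` and the counter `ν ∈ {0, …, d - 1}` are stored as
the words `word n i`, `word n ν`. -/

/-- Basis states of an `n`-qubit index register. -/
abbrev Word (n : ℕ) : Type := Fin (2 ^ n)

/-- The binary representation of `i` (only used for `i < 2 ^ n`). -/
def word (n i : ℕ) : Word n := Fin.ofNat (2 ^ n) i

/-- A computational basis state of the whole memory: index registers of `n` qubits each,
single qubits, and registers that hold (an exact representation of) a complex number.  There is an
unlimited supply of registers of each kind; a circuit touches finitely many of them. -/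
@[ext]
structure Mem (n : ℕ) where
  idx : ℕ → Word n
  bit : ℕ → Bool
  num : ℕ → ℂ

/-- A pair of black-box reversible operations with the types of a sparse-matrix oracle. -/
structure Oracle (n : ℕ) where
  pos : Equiv.Perm (Word n × Word n)
  val : Equiv.Perm (Word n × Word n × ℂ)

/-- `O` is a sparse-matrix-access for `A` with sparsity `d`:
`pos : |i, ν⟩ ↦ |i, j(i, ν)⟩`, where `j(i, 0), …, j(i, d - 1)` contains the positions of all non-zero
entries of row `i`, and `val : |i, j, z⟩ ↦ |i, j, z + A i j⟩`.  Nothing is required of the oracles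
on words that are not such labels.  (Since `pos` is a permutation, `j(i, ·)` is injective.) -/
def IsSparseAccess {n N : ℕ} (O : Oracle n) (A : Matrix (Fin N) (Fin N) ℂ) (d : ℕ) : Prop :=
  (∃ j : Fin N → Fin d → Fin N,
    (∀ (i : Fin N) (ν : Fin d), O.pos (word n i, word n ν) = (word n i, word n (j i ν))) ∧
    ∀ i l, A i l ≠ 0 → ∃ ν, j i ν = l) ∧
  ∀ (i j : Fin N) (z : ℂ), O.val (word n i, word n j, z) = (word n i, word n j, z + A i j)

/-! ### Elementary gates -/

/-- Binary arithmetic operations. -/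
inductive BinOp
  | add | sub | mul | div

def BinOp.eval : BinOp → ℂ → ℂ → ℂ
  | add, x, y => x + y
  | sub, x, y => x - y
  | mul, x, y => x * y
  | div, x, y => x / y

/-- Unary arithmetic operations. -/
inductive UnOp
  | copy | conj | abs | sqrt | arccos | arg

def UnOp.eval : UnOp → ℂ → ℂ
  | copy, x => x
  | conj, x => (starRingEnd ℂ) x
  | abs, x => (‖x‖ : ℝ)
  | sqrt, x => Complex.sqrt x
  | arccos, x => (Real.arccos x.re : ℝ)
  | arg, x => (Complex.arg x : ℝ)

/-- The gate set.  `pos` and `val` are the oracle queries; every other gate acts on at most three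
registers.  Arithmetic on index words and on numbers is reversible: the result is added to, or
(`inv = true`) subtracted from, a target register distinct from the arguments.  The side conditions
say that registers which have to be distinct are distinct. -/
inductive Gate (n : ℕ)
  /-- query of the position oracle, or of its inverse, on the index registers `r`, `s` -/
  | pos (inv : Bool) (r s : ℕ) (h : r ≠ s)
  /-- query of the value oracle, or of its inverse, on `r`, `s` and the number register `t` -/
  | val (inv : Bool) (r s t : ℕ) (h : r ≠ s)
  /-- an arbitrary, exact, single-qubit unitary -/
  | single (b : ℕ) (U : Matrix.unitaryGroup Bool ℂ)
  /-- controlled-not -/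
  | cnot (c b : ℕ) (h : c ≠ b)
  /-- Toffoli gate -/
  | toffoli (c c' b : ℕ) (h : c ≠ b) (h' : c' ≠ b)
  /-- add a constant to an index register -/
  | idxConst (w : Word n) (t : ℕ)
  /-- add the index register `s` to `t` -/
  | idxAdd (inv : Bool) (s t : ℕ) (h : s ≠ t)
  /-- the same, controlled on the qubit `c` -/
  | cIdxAdd (inv : Bool) (c s t : ℕ) (h : s ≠ t)
  /-- swap two index registers -/
  | idxSwap (s t : ℕ)
  /-- flip the qubit `b` if the index registers `r`, `s` are equal -/
  | idxEq (r s b : ℕ)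
  /-- flip the qubit `b` if `r < s` -/
  | idxLt (r s b : ℕ)
  /-- add a rational constant to a number register -/
  | numConst (q : ℚ) (t : ℕ)
  /-- add the bit `b`, as a number, to a number register -/
  | numBit (inv : Bool) (b t : ℕ)
  /-- unary arithmetic -/
  | numUn (inv : Bool) (f : UnOp) (s t : ℕ) (h : s ≠ t)
  /-- binary arithmetic -/
  | numBin (inv : Bool) (f : BinOp) (s s' t : ℕ) (h : s ≠ t) (h' : s' ≠ t)
  /-- on the qubit `b`, controlled on `c`: exact rotation by the angle in the number register `s` -/
  | cRot (c s b : ℕ) (h : c ≠ b)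
  /-- on the qubit `b`, controlled on `c`: exact phase rotation by the angle in `s` -/
  | cPhase (c s b : ℕ) (h : c ≠ b)

/-- `rotation θ` maps `|0⟩` to `cos θ |0⟩ + sin θ |1⟩` and `|1⟩` to `- sin θ |0⟩ + cos θ |1⟩`. -/
def rotation (θ : ℝ) : Matrix Bool Bool ℂ
  | false, false => Real.cos θ
  | true, false => Real.sin θ
  | false, true => -Real.sin θ
  | true, true => Real.cos θ

/-- `phase θ` maps `|0⟩` to `|0⟩` and `|1⟩` to `e^{iθ} |1⟩`. -/
def phase (θ : ℝ) : Matrix Bool Bool ℂ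
  | false, false => 1
  | true, true => Complex.exp (θ * Complex.I)
  | _, _ => 0

variable {n : ℕ}

/-- (Finite) superpositions of basis states of the memory. -/
abbrev State (n : ℕ) : Type := Mem n →₀ ℂ

/-- `|x⟩` -/
def ket (x : Mem n) : State n := Finsupp.single x 1

/-- Replace the contents of one register. -/
def Mem.setIdx (x : Mem n) (t : ℕ) (w : Word n) : Mem n := { x with idx := Function.update x.idx t w }

def Mem.setBit (x : Mem n) (t : ℕ) (b : Bool) : Mem n := { x with bit := Function.update x.bit t b }

def Mem.setNum (x : Mem n) (t : ℕ) (z : ℂ) : Mem n := { x with num := Function.update x.num t z }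

/-- Addition or subtraction, according to the flag `inv`. -/
def addOrSub {R : Type} [Add R] [Sub R] (inv : Bool) (x y : R) : R := if inv then x - y else x + y

/-- A permutation or its inverse, according to the flag `inv`. -/
def fwdOrInv {R : Type} (inv : Bool) (e : Equiv.Perm R) : Equiv.Perm R := if inv then e.symm else e

/-- The matrix `M` applied to the qubit `b` of `|x⟩`. -/
def applyQubit (M : Matrix Bool Bool ℂ) (b : ℕ) (x : Mem n) : State n :=
  ∑ o : Bool, M o (x.bit b) • ket (x.setBit b o)

/-- Action of a gate on a basis state. -/
def Gate.onBasis (O : Oracle n) : Gate n → Mem n → State n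
  | pos inv r s _, x =>
      let y := fwdOrInv inv O.pos (x.idx r, x.idx s)
      ket ((x.setIdx r y.1).setIdx s y.2)
  | val inv r s t _, x =>
      let y := fwdOrInv inv O.val (x.idx r, x.idx s, x.num t)
      ket (((x.setIdx r y.1).setIdx s y.2.1).setNum t y.2.2)
  | single b U, x => applyQubit U.1 b x
  | cnot c b _, x => ket (x.setBit b (x.bit b ^^ x.bit c))
  | toffoli c c' b _ _, x => ket (x.setBit b (x.bit b ^^ (x.bit c && x.bit c')))
  | idxConst w t, x => ket (x.setIdx t (x.idx t + w))
  | idxAdd inv s t _, x => ket (x.setIdx t (addOrSub inv (x.idx t) (x.idx s)))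
  | cIdxAdd inv c s t _, x =>
      ket (if x.bit c then x.setIdx t (addOrSub inv (x.idx t) (x.idx s)) else x)
  | idxSwap s t, x => ket ((x.setIdx s (x.idx t)).setIdx t (x.idx s))
  | idxEq r s b, x => ket (x.setBit b (x.bit b ^^ decide (x.idx r = x.idx s)))
  | idxLt r s b, x => ket (x.setBit b (x.bit b ^^ decide (x.idx r < x.idx s)))
  | numConst q t, x => ket (x.setNum t (x.num t + (q : ℂ)))
  | numBit inv b t, x => ket (x.setNum t (addOrSub inv (x.num t) (if x.bit b then 1 else 0)))
  | numUn inv f s t _, x => ket (x.setNum t (addOrSub inv (x.num t) (f.eval (x.num s))))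
  | numBin inv f s s' t _ _, x =>
      ket (x.setNum t (addOrSub inv (x.num t) (f.eval (x.num s) (x.num s'))))
  | cRot c s b _, x => if x.bit c then applyQubit (rotation (x.num s).re) b x else ket x
  | cPhase c s b _, x => if x.bit c then applyQubit (phase (x.num s).re) b x else ket x

/-! ### Circuits and their cost -/

/-- A circuit is a sequence of gates, the first one being applied first. -/
abbrev Circuit (n : ℕ) : Type := List (Gate n)

def Gate.isQuery : Gate n → Bool
  | pos .. => true
  | val .. => true
  | _ => false

/-- Query complexity: the number of calls to the oracles and their inverses. -/
def Circuit.queries (c : Circuit n) : ℕ := c.countP (fun g => g.isQuery)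

/-- Gate complexity: the number of gates that are not queries. -/
def Circuit.gates (c : Circuit n) : ℕ := c.countP (fun g => !g.isQuery)

/-- The linear operator that a circuit realises on superpositions. -/
def Circuit.run (O : Oracle n) : Circuit n → State n →ₗ[ℂ] State n
  | [] => LinearMap.id
  | g :: c => (Circuit.run O c).comp (Finsupp.linearCombination ℂ (g.onBasis O))

/-! ### The qubits on which the block-encoding acts

The block-encoding acts on two registers of `n + 1` qubits.  Such a register holds a label
`l ∈ {0, …, N - 1}`, or the additional label "`N + 1`".  The `n` system qubits are the index part of the
first register; the other `n + 2` qubits are the ancillas on which one post-selects. -/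

/-- Basis states of a register of `n + 1` qubits. -/
abbrev Label (n : ℕ) : Type := Word n × Bool

/-- The basis state `|l⟩` with `l < N`. -/
def label (n l : ℕ) : Label n := (word n l, false)

/-- The additional basis state, orthogonal to all `|l⟩`. -/
def lastLabel (n : ℕ) : Label n := (word n 0, true)

/-- Basis states of the `n + 2` post-selected ancilla qubits: the additional qubit of the first
register, and the second register. -/
abbrev Anc (n : ℕ) : Type := Bool × Label n

/-- The ancilla state `|0^a⟩`. -/
def ancZero (n : ℕ) : Anc n := (false, word n 0, false)

/-- Contents of the first and of the second register. -/
def reg₁ (x : Anc n × Word n) : Label n := (x.2, x.1.1)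

def reg₂ (x : Anc n × Word n) : Label n := x.1.2

/-- The memory in which the two registers occupy index registers 0, 1 and qubits 0, 1 and everything
else is zero. -/
def load (x : Anc n × Word n) : Mem n where
  idx k := if k = 0 then (reg₁ x).1 else if k = 1 then (reg₂ x).1 else word n 0
  bit k := if k = 0 then (reg₁ x).2 else if k = 1 then (reg₂ x).2 else false
  num _ := 0

/-- With oracle `O`, the circuit `c` implements the operator `U` on the `n + (n + 2)` qubits; all
further registers are zero before and after. -/
def Implements (O : Oracle n) (c : Circuit n) (U : Matrix (Anc n × Word n) (Anc n × Word n) ℂ) :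
    Prop :=
  ∀ x, c.run O (ket (load x)) = ∑ y, U y x • ket (load y)

/-- `U` is an `(α, a, ε)`-matrix-block-encoding of the `n`-qubit operator `M`: it is unitary on `n + a`
qubits, where `𝒜` labels the basis of the `a` ancilla qubits and `z` is their state `|0^a⟩`, and
`‖M - α (⟨0^a| ⊗ I) U (|0^a⟩ ⊗ I)‖ ≤ ε` in the operator norm. -/
def IsBlockEncoding {𝒜 : Type} [Fintype 𝒜] [DecidableEq 𝒜] (α : ℝ) (a : ℕ) (ε : ℝ) (z : 𝒜)
    (U : Matrix (𝒜 × Word n) (𝒜 × Word n) ℂ) (M : Matrix (Word n) (Word n) ℂ) : Prop :=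
  Fintype.card 𝒜 = 2 ^ a ∧
  U ∈ Matrix.unitaryGroup (𝒜 × Word n) ℂ ∧
  ‖Matrix.toEuclideanCLM (𝕜 := ℂ)
    (M - (α : ℂ) • Matrix.of fun i j => U (z, i) (z, j))‖ ≤ ε

/-- An `N × N` matrix as an `n`-qubit operator, padded with zeroes. -/
def padded {N : ℕ} (n : ℕ) (B : Matrix (Fin N) (Fin N) ℂ) : Matrix (Word n) (Word n) ℂ :=
  Matrix.of fun x y => if h : x.val < N ∧ y.val < N then B ⟨x, h.1⟩ ⟨y, h.2⟩ else 0

/-! ### The states -/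

/-- `r_i = A_ii - ∑_{l ≠ i} |A_il|` -/
def rest {N : ℕ} (A : Matrix (Fin N) (Fin N) ℂ) (i : Fin N) : ℝ :=
  (A i i).re - ∑ l ∈ Finset.univ.erase i, ‖A i l‖

open Classical in
/-- `|ψ_i⟩ = ∑_{l ∈ supp A_i} √(δ_il - A_il) |l⟩ + √r_i |N+1⟩` -/
def psi {N : ℕ} (n : ℕ) (A : Matrix (Fin N) (Fin N) ℂ) (i : Fin N) : Label n → ℂ :=
  (∑ l with A i l ≠ 0, Complex.sqrt ((if i = l then 1 else 0) - A i l) • Pi.single (label n l) 1)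
    + ((√(rest A i) : ℝ) : ℂ) • Pi.single (lastLabel n) 1

open Classical in
/-- `|φ_j⟩ = ∑_{k ∈ supp A_j} √(δ_jk - A_jk^*) |k⟩ + √r_j |N+1⟩` -/
def phi {N : ℕ} (n : ℕ) (A : Matrix (Fin N) (Fin N) ℂ) (j : Fin N) : Label n → ℂ :=
  (∑ k with A j k ≠ 0,
      Complex.sqrt ((if j = k then 1 else 0) - (starRingEnd ℂ) (A j k)) • Pi.single (label n k) 1)
    + ((√(rest A j) : ℝ) : ℂ) • Pi.single (lastLabel n) 1

/-- `U : |0^a⟩|i⟩ ↦ |i⟩|ψ_i^*⟩` for all `i < N` -/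
def PreparesLeft {N : ℕ} (A : Matrix (Fin N) (Fin N) ℂ)
    (U : Matrix (Anc n × Word n) (Anc n × Word n) ℂ) : Prop :=
  ∀ (i : Fin N) (y : Anc n × Word n), U y (ancZero n, word n i) =
    (if reg₁ y = label n i then 1 else 0) * (starRingEnd ℂ) (psi n A i (reg₂ y))

/-- `U : |0^a⟩|j⟩ ↦ |φ_j⟩|j⟩` for all `j < N` -/
def PreparesRight {N : ℕ} (A : Matrix (Fin N) (Fin N) ℂ)
    (U : Matrix (Anc n × Word n) (Anc n × Word n) ℂ) : Prop :=
  ∀ (j : Fin N) (y : Anc n × Word n), U y (ancZero n, word n j) =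
    phi n A j (reg₁ y) * (if reg₂ y = label n j then 1 else 0)

end PDQLS

end


/-!
Row `r` of `B = 1 - A` becomes a unit vector with the weights `‖B r l‖` on the labels and the
residual weight `1 - ∑ l, ‖B r l‖ = rest A r`, which diagonal dominance makes nonnegative, on the
last label.  It is prepared entry by entry.  Next to the unspent amplitude in `|0⟩|0⟩`, a number
register holds the residual weight `S`, initially `1`; step `ν` looks up the entry `t` at the `ν`-th
position `p`, rotates between `|0⟩|0⟩` and `|p⟩|1⟩` by the angle `arccos √((S - t) / S)`, replaces
`S` by `S - t` and uncomputes everything else.  Adding the weights back restores `S` in the end, and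
a final flip of the qubit turns `|p⟩|1⟩` into the label `p` and the unspent `|0⟩|0⟩` into the last
label.  Words that are not labels are treated like a label, so that the ancillas return to zero on
every input and the circuit implements a unitary on all of the `n + (n + 2)` qubits.

Taking `√·` for the amplitudes of `U_R` and its conjugate for those of `U_L`, the entry `(i, j)` of
the block of `U_L† U_R` is the product of two equal roots of `B i j`, because `B` is Hermitian.
-/
noncomputable section

namespace PDQLS

variable {n : ℕ}

/-! ### Registers -/

namespace Mem

variable (x : Mem n) (s t : ℕ)

@[simp] lemma idx_setIdx (w : Word n) :
    (x.setIdx t w).idx s = if s = t then w else x.idx s :=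
  Function.update_apply ..

@[simp] lemma bit_setIdx (w : Word n) : (x.setIdx t w).bit = x.bit := rfl

@[simp] lemma num_setIdx (w : Word n) : (x.setIdx t w).num = x.num := rfl

@[simp] lemma bit_setBit (b : Bool) : (x.setBit t b).bit s = if s = t then b else x.bit s :=
  Function.update_apply ..

@[simp] lemma idx_setBit (b : Bool) : (x.setBit t b).idx = x.idx := rfl

@[simp] lemma num_setBit (b : Bool) : (x.setBit t b).num = x.num := rfl

@[simp] lemma num_setNum (z : ℂ) : (x.setNum t z).num s = if s = t then z else x.num s :=
  Function.update_apply ..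

@[simp] lemma idx_setNum (z : ℂ) : (x.setNum t z).idx = x.idx := rfl

@[simp] lemma bit_setNum (z : ℂ) : (x.setNum t z).bit = x.bit := rfl

@[simp] lemma setIdx_self : x.setIdx t (x.idx t) = x := by simp [setIdx]

@[simp] lemma setBit_self : x.setBit t (x.bit t) = x := by simp [setBit]

@[simp] lemma setNum_self : x.setNum t (x.num t) = x := by simp [setNum]

@[simp] lemma setIdx_setIdx (w w' : Word n) : (x.setIdx t w).setIdx t w' = x.setIdx t w' := by
  simp [setIdx]

@[simp] lemma setBit_setBit (b b' : Bool) : (x.setBit t b).setBit t b' = x.setBit t b' := by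
  simp [setBit]

@[simp] lemma setNum_setNum (z z' : ℂ) : (x.setNum t z).setNum t z' = x.setNum t z' := by
  simp [setNum]

lemma setBit_right_injective : Function.Injective (x.setBit t) := fun b b' h => by
  simpa using congrArg (fun y => y.bit t) h

end Mem

/-! ### Running circuits -/

@[simp] lemma run_nil (O : Oracle n) (v : State n) : Circuit.run O [] v = v := rfl

lemma run_cons_ket (O : Oracle n) (g : Gate n) (c : Circuit n) (x : Mem n) :
    Circuit.run O (g :: c) (ket x) = Circuit.run O c (g.onBasis O x) := by
  simp [Circuit.run, ket]

lemma run_append (O : Oracle n) (c c' : Circuit n) (v : State n) :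
    Circuit.run O (c ++ c') v = Circuit.run O c' (Circuit.run O c v) := by
  induction c generalizing v with
  | nil => rfl
  | cons _ _ ih => exact ih _

lemma run_cons (O : Oracle n) (g : Gate n) (c : Circuit n) (v : State n) :
    Circuit.run O (g :: c) v = Circuit.run O c (Circuit.run O [g] v) :=
  run_append O [g] c v

lemma single_eq_smul_ket (x : Mem n) (a : ℂ) : (Finsupp.single x a : State n) = a • ket x := by
  simp [ket]

lemma linearMap_ext_ket {V : Type*} [AddCommMonoid V] [Module ℂ V] {f g : State n →ₗ[ℂ] V}
    (h : ∀ x, f (ket x) = g (ket x)) : f = g :=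
  Finsupp.lhom_ext fun x a => by rw [single_eq_smul_ket, map_smul, map_smul, h]

/-! ### The inner product of superpositions -/

/-- The inner product `⟨v|w⟩` of superpositions, conjugate-linear in `v`. -/
def braket : State n →ₗ⋆[ℂ] State n →ₗ[ℂ] ℂ :=
  LinearMap.mk₂'ₛₗ (starRingEnd ℂ) (RingHom.id ℂ)
    (fun v w => v.sum fun x a => (starRingEnd ℂ) a * w x)
    (fun _ _ _ => Finsupp.sum_add_index' (by simp) (by simp [add_mul]))
    (fun _ _ _ => by simp [Finsupp.sum_smul_index, Finsupp.mul_sum, mul_assoc])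
    (fun _ _ _ => by simp [mul_add, Finsupp.sum_add])
    (fun _ _ _ => by simp [Finsupp.mul_sum, mul_left_comm])

@[simp] lemma braket_ket_left (x : Mem n) (w : State n) : braket (ket x) w = w x := by
  simp [braket, ket]

open Classical in
lemma braket_ket_ket (x y : Mem n) : braket (ket x) (ket y) = if x = y then 1 else 0 := by
  rw [braket_ket_left, ket, Finsupp.single_apply, if_congr eq_comm rfl rfl]

lemma isometry_of_ket (T : State n →ₗ[ℂ] State n)
    (h : ∀ x y, braket (T (ket x)) (T (ket y)) = braket (ket x) (ket y)) (v w : State n) :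
    braket (T v) (T w) = braket v w := by
  induction v using Finsupp.induction_linear with
  | zero => simp
  | add u v hu hv => simp only [map_add, LinearMap.add_apply, hu, hv]
  | single x a =>
    induction w using Finsupp.induction_linear with
    | zero => simp
    | add u v hu hv => simp only [map_add, hu, hv]
    | single y b =>
      simp only [single_eq_smul_ket, map_smul, map_smulₛₗ, LinearMap.smul_apply, h]

/-! ### Circuits acting on one qubit -/

lemma applyQubit_one (b : ℕ) (x : Mem n) : applyQubit 1 b x = ket x := by
  rw [applyQubit, Finset.sum_eq_single (x.bit b)] <;> simp +contextual

namespace Circuit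

/-- The circuit `c` acts on the qubit `b` alone, by a matrix `M x` controlled by the contents `x` of
the other registers. -/
structure ActsOnQubit (O : Oracle n) (c : Circuit n) (b : ℕ) (M : Mem n → Matrix Bool Bool ℂ) :
    Prop where
  run_ket : ∀ x, c.run O (ket x) = applyQubit (M x) b x
  setBit_eq : ∀ x o, M (x.setBit b o) = M x

namespace ActsOnQubit

variable {O : Oracle n} {c c' : Circuit n} {b : ℕ} {M M' : Mem n → Matrix Bool Bool ℂ}

lemma append (h : ActsOnQubit O c b M) (h' : ActsOnQubit O c' b M') :
    ActsOnQubit O (c ++ c') b fun x => M' x * M x where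
  run_ket x := by
    rw [run_append, h.run_ket, applyQubit, map_sum]
    simp_rw [map_smul, h'.run_ket, h'.setBit_eq, applyQubit, Matrix.mul_apply, Mem.bit_setBit,
      Mem.setBit_setBit, if_true, Finset.smul_sum, Finset.sum_smul, smul_smul]
    rw [Finset.sum_comm]
    simp_rw [mul_comm]
  setBit_eq x o := by rw [h.setBit_eq, h'.setBit_eq]

lemma braket_run_setBit (h : ActsOnQubit O c b M) (x : Mem n) (o : Bool) :
    braket (c.run O (ket x)) (c.run O (ket (x.setBit b o))) = ((M x)ᴴ * M x) (x.bit b) o := by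
  classical
  simp [h.run_ket, h.setBit_eq, applyQubit, braket_ket_ket, (x.setBit_right_injective b).eq_iff,
    Matrix.mul_apply, -Fintype.univ_bool, -braket_ket_left, mul_comm]

lemma braket_run (h : ActsOnQubit O c b M) (hM : ∀ x, (M x)ᴴ * M x = 1) (x y : Mem n) :
    braket (c.run O (ket x)) (c.run O (ket y)) = braket (ket x) (ket y) := by
  classical
  by_cases hxy : ∃ o, x.setBit b o = y
  · obtain ⟨o, rfl⟩ := hxy
    have hx : x = x.setBit b o ↔ x.bit b = o := by
      rw [← (x.setBit_right_injective b).eq_iff, x.setBit_self]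
    simp only [h.braket_run_setBit, hM, Matrix.one_apply, braket_ket_ket, hx]
  · have hne (o o' : Bool) : x.setBit b o ≠ y.setBit b o' := fun e =>
      hxy ⟨y.bit b, by simpa using congrArg (fun z => z.setBit b (y.bit b)) e⟩
    have hxy' : x ≠ y := fun e => hxy ⟨y.bit b, by rw [e, y.setBit_self b]⟩
    simp [h.run_ket, applyQubit, braket_ket_ket, hne, hxy', -braket_ket_left]

end ActsOnQubit

variable (O : Oracle n) (b : ℕ) (U V : Matrix.unitaryGroup Bool ℂ) (c s : ℕ)

lemma actsOnQubit_single : ActsOnQubit O [.single b U] b fun _ => U :=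
  ⟨fun x => by rw [run_cons_ket]; rfl, fun _ _ => rfl⟩

variable {b c} (h : c ≠ b)

lemma actsOnQubit_cRot : ActsOnQubit O [.cRot c s b h] b fun x =>
    if x.bit c then rotation (x.num s).re else 1 where
  run_ket x := by
    rw [run_cons_ket, run_nil]
    cases hx : x.bit c <;> simp [Gate.onBasis, hx, applyQubit_one]
  setBit_eq x o := by simp [h]

lemma actsOnQubit_cPhase : ActsOnQubit O [.cPhase c s b h] b fun x =>
    if x.bit c then phase (x.num s).re else 1 where
  run_ket x := by
    rw [run_cons_ket, run_nil]
    cases hx : x.bit c <;> simp [Gate.onBasis, hx, applyQubit_one]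
  setBit_eq x o := by simp [h]

/-- A controlled rotation conjugated by the single-qubit unitary `V`. -/
def conjRotation : Circuit n := [.single b V, .cRot c s b h, .single b V⁻¹]

lemma actsOnQubit_conjRotation : ActsOnQubit O (conjRotation V s h) b fun x =>
    if x.bit c then (V⁻¹).1 * (rotation (x.num s).re * V.1) else 1 := by
  have hVRV := (actsOnQubit_single O b V).append
    ((actsOnQubit_cRot O s h).append (actsOnQubit_single O b V⁻¹))
  convert hVRV using 1
  · rfl
  · funext x
    split_ifs
    · rw [Matrix.mul_assoc]
    · simp

end Circuit

/-! ### Inverse circuits -/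

lemma conjTranspose_rotation_mul_self (θ : ℝ) : (rotation θ)ᴴ * rotation θ = 1 := by
  ext i j
  cases i <;> cases j <;>
    simp [Matrix.mul_apply, rotation, ← Complex.cos_conj, ← Complex.sin_conj, ← sq, mul_comm]

lemma conjTranspose_phase_mul_self (θ : ℝ) : (phase θ)ᴴ * phase θ = 1 := by
  ext i j
  cases i <;> cases j <;> simp [Matrix.mul_apply, phase, ← Complex.exp_conj, ← Complex.exp_add]

/-- The Pauli matrix `Z`; conjugation by it inverts a rotation. -/
def pauliZ : Matrix.unitaryGroup Bool ℂ :=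
  ⟨Matrix.diagonal fun b => if b then -1 else 1, by
    rw [Matrix.mem_unitaryGroup_iff, Matrix.star_eq_conjTranspose, Matrix.diagonal_conjTranspose,
      Matrix.diagonal_mul_diagonal, ← Matrix.diagonal_one]
    congr 1; funext b; cases b <;> simp⟩

lemma pauliZ_conj_rotation (θ : ℝ) :
    (pauliZ⁻¹).1 * (rotation θ * pauliZ.1) = (rotation θ)ᴴ := by
  rw [Matrix.UnitaryGroup.inv_val, Matrix.star_eq_conjTranspose, pauliZ,
    Matrix.diagonal_conjTranspose]
  ext i j
  cases i <;> cases j <;> simp [rotation, ← Complex.cos_conj, ← Complex.sin_conj]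

namespace Gate

/-- The controlled phase rotations. Unlike a controlled rotation, such a gate has no inverse made up
of gates acting on the same qubits, since the angle cannot be negated in place. -/
def isPhase : Gate n → Bool
  | cPhase .. => true
  | _ => false

/-- The inverse of a gate other than `cPhase`; the value at `cPhase` is junk. -/
def adj : Gate n → Circuit n
  | pos inv r s h => [pos (!inv) r s h]
  | val inv r s t h => [val (!inv) r s t h]
  | single b U => [single b U⁻¹]
  | cnot c b h => [cnot c b h]
  | toffoli c c' b h h' => [toffoli c c' b h h']
  | idxConst w t => [idxConst (-w) t]
  | idxAdd inv s t h => [idxAdd (!inv) s t h]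
  | cIdxAdd inv c s t h => [cIdxAdd (!inv) c s t h]
  | idxSwap s t => [idxSwap s t]
  | idxEq r s b => [idxEq r s b]
  | idxLt r s b => [idxLt r s b]
  | numConst q t => [numConst (-q) t]
  | numBit inv b t => [numBit (!inv) b t]
  | numUn inv f s t h => [numUn (!inv) f s t h]
  | numBin inv f s s' t h h' => [numBin (!inv) f s s' t h h']
  | cRot _ s _ h => Circuit.conjRotation pauliZ s h
  | cPhase .. => []

end Gate

@[simp] lemma addOrSub_not {R : Type} [AddGroup R] (inv : Bool) (x y : R) :
    addOrSub (!inv) (addOrSub inv x y) y = x := by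
  cases inv <;> simp [addOrSub]

@[simp] lemma fwdOrInv_not {R : Type} (inv : Bool) (e : Equiv.Perm R) (x : R) :
    fwdOrInv (!inv) e (fwdOrInv inv e x) = x := by
  cases inv <;> simp [fwdOrInv]

lemma Circuit.ActsOnQubit.run_append_ket {O : Oracle n} {c c' : Circuit n} {b : ℕ}
    {M M' : Mem n → Matrix Bool Bool ℂ} (h : ActsOnQubit O c b M) (h' : ActsOnQubit O c' b M')
    (hM : ∀ x, M' x * M x = 1) (x : Mem n) : c'.run O (c.run O (ket x)) = ket x := by
  rw [← run_append, (h.append h').run_ket, hM, applyQubit_one]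

lemma Gate.run_adj_ket (O : Oracle n) (g : Gate n) (hg : g.isPhase = false) (x : Mem n) :
    Circuit.run O g.adj (Circuit.run O [g] (ket x)) = ket x := by
  cases g with
  | cPhase => cases hg
  | single b U =>
    refine (Circuit.actsOnQubit_single O b U).run_append_ket
      (Circuit.actsOnQubit_single O b U⁻¹) (fun _ => ?_) x
    simp
  | cRot c s b h =>
    refine (Circuit.actsOnQubit_cRot O s h).run_append_ket
      (Circuit.actsOnQubit_conjRotation O pauliZ s h) (fun x => ?_) x
    split_ifs
    · rw [pauliZ_conj_rotation, conjTranspose_rotation_mul_self]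
    · rw [Matrix.mul_one]
  | pos inv r s h =>
    simp only [adj, run_cons_ket, run_nil, onBasis]
    congr 1
    ext k <;> simp [h]
    split_ifs <;> simp_all
  | val inv r s t h =>
    simp only [adj, run_cons_ket, run_nil, onBasis]
    congr 1
    ext k <;> simp [h] <;> split_ifs <;> simp_all
  | idxSwap s t =>
    simp only [adj, run_cons_ket, run_nil, onBasis]
    congr 1
    ext k <;> simp
    split_ifs <;> simp_all
  | cIdxAdd inv c s t h => cases hc : x.bit c <;> simp [adj, run_cons_ket, onBasis, hc, h]
  | numBit inv b t => cases hb : x.bit b <;> simp [adj, run_cons_ket, onBasis, hb]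
  | idxEq r s b => by_cases hrs : x.idx r = x.idx s <;> simp [adj, run_cons_ket, onBasis, hrs]
  | idxLt r s b => by_cases hrs : x.idx r < x.idx s <;> simp [adj, run_cons_ket, onBasis, hrs]
  | cnot c b h | idxAdd inv s t h | numUn inv f s t h => simp [adj, run_cons_ket, onBasis, h]
  | toffoli c c' b h h' | numBin inv f s s' t h h' => simp [adj, run_cons_ket, onBasis, h, h']
  | _ => simp [adj, run_cons_ket, onBasis]

lemma Gate.braket_run_of_onBasis_eq_ket (O : Oracle n) (g : Gate n) (hg : g.isPhase = false)
    {f : Mem n → Mem n} (hf : ∀ x, g.onBasis O x = ket (f x)) (x y : Mem n) :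
    braket (Circuit.run O [g] (ket x)) (Circuit.run O [g] (ket y)) = braket (ket x) (ket y) := by
  classical
  have hf_inj : f x = f y ↔ x = y := by
    refine ⟨fun h => ?_, congrArg f⟩
    have hket : ket x = ket y := by
      rw [← g.run_adj_ket O hg x, ← g.run_adj_ket O hg y, run_cons_ket, run_cons_ket, hf, hf, h]
    exact Finsupp.single_left_injective one_ne_zero hket
  simp only [run_cons_ket, run_nil, hf, braket_ket_ket, hf_inj]

lemma Gate.braket_run (O : Oracle n) (g : Gate n) (v w : State n) :
    braket (Circuit.run O [g] v) (Circuit.run O [g] w) = braket v w := by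
  refine isometry_of_ket _ (fun x y => ?_) v w
  cases g with
  | single b U =>
    exact (Circuit.actsOnQubit_single O b U).braket_run
      (fun _ => Matrix.mem_unitaryGroup_iff'.1 U.2) x y
  | cRot c s b h =>
    refine (Circuit.actsOnQubit_cRot O s h).braket_run (fun x => ?_) x y
    split_ifs <;> simp [conjTranspose_rotation_mul_self]
  | cPhase c s b h =>
    refine (Circuit.actsOnQubit_cPhase O s h).braket_run (fun x => ?_) x y
    split_ifs <;> simp [conjTranspose_phase_mul_self]
  | _ => exact Gate.braket_run_of_onBasis_eq_ket O _ rfl (fun _ => rfl) x y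

namespace Circuit

/-- The circuits without controlled phase rotations, which are those that `Circuit.adj` inverts. -/
def PhaseFree (c : Circuit n) : Prop := ∀ g ∈ c, g.isPhase = false

/-- The inverse of a circuit without controlled phase rotations. -/
def adj (c : Circuit n) : Circuit n := c.reverse.flatMap Gate.adj

lemma PhaseFree.append {c c' : Circuit n} (hc : c.PhaseFree) (hc' : c'.PhaseFree) :
    (c ++ c').PhaseFree :=
  List.forall_mem_append.2 ⟨hc, hc'⟩

lemma PhaseFree.flatMap {ι : Type*} {F : ι → Circuit n} (hF : ∀ i, (F i).PhaseFree)
    (l : List ι) : PhaseFree (l.flatMap F) := fun _ hg => by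
  obtain ⟨i, -, hi⟩ := List.mem_flatMap.1 hg
  exact hF i _ hi

lemma phaseFree_adj (c : Circuit n) : c.adj.PhaseFree :=
  PhaseFree.flatMap (fun g => by cases g <;> simp [PhaseFree, Gate.adj, conjRotation, Gate.isPhase])
    c.reverse

lemma adj_cons (g : Gate n) (c : Circuit n) : adj (g :: c) = adj c ++ g.adj := by simp [adj]

lemma length_adj_le (c : Circuit n) : c.adj.length ≤ 3 * c.length := by
  induction c with
  | nil => simp [adj]
  | cons g c ih =>
    have hg : g.adj.length ≤ 3 := by cases g <;> simp [Gate.adj, conjRotation]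
    rw [adj_cons, List.length_append, List.length_cons]
    lia

lemma run_adj_run (O : Oracle n) {c : Circuit n} (hc : c.PhaseFree) (v : State n) :
    c.adj.run O (c.run O v) = v := by
  induction c generalizing v with
  | nil => rfl
  | cons g c ih =>
    obtain ⟨hg, hc⟩ := List.forall_mem_cons.1 hc
    have hgate : (run O g.adj).comp (run O [g]) = LinearMap.id :=
      linearMap_ext_ket (g.run_adj_ket O hg)
    rw [adj_cons, run_append, run_cons, ih hc]
    exact LinearMap.congr_fun hgate v

lemma braket_run (O : Oracle n) (c : Circuit n) (v w : State n) :
    braket (c.run O v) (c.run O w) = braket v w := by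
  induction c generalizing v w with
  | nil => rfl
  | cons g c ih => rw [run_cons, run_cons O g c w, ih, g.braket_run]

end Circuit

/-! ### Circuits that implement unitaries -/

lemma load_injective : Function.Injective (load (n := n)) := by
  rintro ⟨⟨a, w, b⟩, i⟩ ⟨⟨a', w', b'⟩, i'⟩ h
  have h_idx := fun k => congrFun (congrArg Mem.idx h) k
  have h_bit := fun k => congrFun (congrArg Mem.bit h) k
  have hi : i = i' := h_idx 0
  have hw : w = w' := h_idx 1
  have ha : a = a' := h_bit 0
  have hb : b = b' := h_bit 1
  rw [hi, hw, ha, hb]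

/-- A superposition of the contents of the two registers, as a superposition of memories. -/
def loadState (n : ℕ) : (Anc n × Word n → ℂ) →ₗ[ℂ] State n :=
  Fintype.linearCombination ℂ fun x => ket (load x)

open Classical in
lemma loadState_single (x : Anc n × Word n) : loadState n (Pi.single x 1) = ket (load x) := by
  simp [loadState, Fintype.linearCombination_apply_single]

lemma loadState_apply_load (v : Anc n × Word n → ℂ) (y : Anc n × Word n) :
    loadState n v (load y) = v y := by
  classical
  simp [loadState, Fintype.linearCombination_apply, Finsupp.finsetSum_apply, ket,
    Finsupp.single_apply, load_injective.eq_iff]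

lemma braket_loadState (v w : Anc n × Word n → ℂ) :
    braket (loadState n v) (loadState n w) = star v ⬝ᵥ w := by
  conv_lhs => enter [1, 2]; rw [loadState, Fintype.linearCombination_apply]
  simp [loadState_apply_load, dotProduct]

namespace Implements

variable {O : Oracle n} {c c' : Circuit n} {U U' : Matrix (Anc n × Word n) (Anc n × Word n) ℂ}

lemma run_loadState (h : Implements O c U) (v : Anc n × Word n → ℂ) :
    c.run O (loadState n v) = loadState n (U *ᵥ v) := by
  classical
  have hext : (c.run O).comp (loadState n) = (loadState n).comp U.mulVecLin := by
    refine LinearMap.pi_ext' fun x => LinearMap.ext_ring ?_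
    simp [h x, loadState, Fintype.linearCombination_apply]
  exact LinearMap.congr_fun hext v

lemma of_run_loadState (h : ∀ v, c.run O (loadState n v) = loadState n (U *ᵥ v)) :
    Implements O c U := fun x => by
  classical
  rw [← loadState_single, h, Matrix.mulVec_single_one]
  rfl

lemma apply_eq (h : Implements O c U) (x y : Anc n × Word n) :
    U y x = c.run O (ket (load x)) (load y) := by
  rw [h x]
  exact (loadState_apply_load (fun y => U y x) y).symm

lemma append (h : Implements O c U) (h' : Implements O c' U') :
    Implements O (c ++ c') (U' * U) := of_run_loadState fun v => by
  rw [run_append, h.run_loadState, h'.run_loadState, Matrix.mulVec_mulVec]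

lemma mem_unitaryGroup (h : Implements O c U) :
    U ∈ Matrix.unitaryGroup (Anc n × Word n) ℂ := by
  refine Matrix.mem_unitaryGroup_iff'.2 (Matrix.ext fun x y => ?_)
  have hxy : star (U *ᵥ Pi.single x 1) ⬝ᵥ (U *ᵥ Pi.single y 1) =
      star (Pi.single x 1) ⬝ᵥ Pi.single y 1 := by
    rw [← braket_loadState, ← h.run_loadState, ← h.run_loadState, Circuit.braket_run,
      braket_loadState]
  simpa [Matrix.mul_apply, dotProduct, Matrix.one_apply, Pi.single_apply, Matrix.star_apply,
    eq_comm] using hxy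

lemma adj (hc : c.PhaseFree) (h : Implements O c U) : Implements O c.adj Uᴴ :=
  of_run_loadState fun v => by
    have hUU : U * Uᴴ = 1 := Matrix.mem_unitaryGroup_iff.1 h.mem_unitaryGroup
    have hv : loadState n v = c.run O (loadState n (Uᴴ *ᵥ v)) := by
      rw [h.run_loadState, Matrix.mulVec_mulVec, hUU, Matrix.one_mulVec]
    rw [hv, Circuit.run_adj_run O hc]

end Implements

lemma exists_implements {O : Oracle n} {c : Circuit n}
    (h : ∀ x, c.run O (ket (load x)) ∈ LinearMap.range (loadState n)) : ∃ U, Implements O c U := by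
  choose u hu using h
  exact ⟨Matrix.of fun y x => u x y, fun x => (hu x).symm⟩

/-! ### Two-level rotations -/

/-- The Pauli matrix `X`. -/
def pauliX : Matrix.unitaryGroup Bool ℂ :=
  ⟨Matrix.of fun i j => if i = j then 0 else 1, by
    rw [Matrix.mem_unitaryGroup_iff]
    ext i j
    cases i <;> cases j <;> simp [Matrix.mul_apply, Matrix.star_apply]⟩

/-- The unitary whose columns `(1, i)/√2` and `(1, -i)/√2` are eigenvectors of every rotation. -/
def rotEigenbasis : Matrix.unitaryGroup Bool ℂ :=
  ⟨((√2 : ℝ) : ℂ)⁻¹ •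
      Matrix.of fun i j => if i then (if j then -Complex.I else Complex.I) else 1, by
    have hsqrt : ((√2 : ℝ) : ℂ)⁻¹ * ((√2 : ℝ) : ℂ)⁻¹ = 2⁻¹ := by
      rw [← mul_inv, ← Complex.ofReal_mul, Real.mul_self_sqrt (by norm_num), Complex.ofReal_ofNat]
    rw [Matrix.mem_unitaryGroup_iff, star_smul, star_inv₀, Complex.star_def, Complex.conj_ofReal,
      smul_mul_smul_comm, hsqrt]
    ext i j
    cases i <;> cases j <;> norm_num [Matrix.mul_apply, Matrix.star_apply]⟩

/-- The matrix `diag(e^{-iβ}, e^{iβ})`. -/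
def twist (β : ℝ) : Matrix Bool Bool ℂ :=
  Matrix.diagonal fun b => Complex.exp ((if b then β else -β) * Complex.I)

lemma rotation_mul_rotEigenbasis (β : ℝ) :
    rotation β * rotEigenbasis.1 = rotEigenbasis.1 * twist β := by
  rw [rotEigenbasis, Matrix.mul_smul, Matrix.smul_mul]
  congr 1
  ext i j
  rw [twist, Matrix.mul_diagonal, Matrix.mul_apply]
  cases i <;> cases j <;> simp [rotation, Complex.exp_mul_I, -neg_mul] <;> ring_nf <;>
    simp

lemma rotEigenbasis_conj_rotation (β : ℝ) :
    (rotEigenbasis⁻¹).1 * (rotation β * rotEigenbasis.1) = twist β := by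
  rw [rotation_mul_rotEigenbasis, ← Matrix.mul_assoc, ← Matrix.UnitaryGroup.mul_val,
    inv_mul_cancel, Matrix.UnitaryGroup.one_val, Matrix.one_mul]

lemma pauliX_conj_twist (β : ℝ) : (pauliX⁻¹).1 * (twist β * pauliX.1) = twist (-β) := by
  rw [Matrix.UnitaryGroup.inv_val]
  ext i j
  cases i <;> cases j <;> simp [pauliX, twist, Matrix.mul_apply, Matrix.star_apply]

lemma rotEigenbasis_mul_pauliX_conj_rotation (β : ℝ) :
    ((rotEigenbasis * pauliX)⁻¹).1 * (rotation β * (rotEigenbasis * pauliX).1) = twist (-β) := by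
  rw [mul_inv_rev, Matrix.UnitaryGroup.mul_val, Matrix.UnitaryGroup.mul_val,
    ← pauliX_conj_twist, ← rotEigenbasis_conj_rotation]
  simp only [Matrix.mul_assoc]

/-- The rotation by `θ` conjugated by `twist β`, which gives the rotated amplitude the phase
`e^{2iβ}`. -/
def twistedRotation (β θ : ℝ) : Matrix Bool Bool ℂ := twist β * (rotation θ * twist (-β))

lemma twistedRotation_false_false (β θ : ℝ) :
    twistedRotation β θ false false = Complex.cos θ := by
  simp [twistedRotation, twist, rotation, mul_left_comm, ← Complex.exp_add]

lemma twistedRotation_true_false (β θ : ℝ) :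
    twistedRotation β θ true false = Complex.exp (β * Complex.I) ^ 2 * Complex.sin θ := by
  simp [twistedRotation, twist, rotation]
  ring

/-- The twisted rotation of the qubit `1`, controlled on the qubit `2`, whose angles are stored in
the number registers `6` and `11`. -/
def twistedRotationCircuit : Circuit n :=
  Circuit.conjRotation (rotEigenbasis * pauliX) 6 (show 2 ≠ 1 by decide) ++
    ([.cRot 2 11 1 (by decide)] ++ Circuit.conjRotation rotEigenbasis 6 (show 2 ≠ 1 by decide))

lemma actsOnQubit_twistedRotationCircuit (O : Oracle n) :
    Circuit.ActsOnQubit O twistedRotationCircuit 1 fun x =>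
      if x.bit 2 then twistedRotation (x.num 6).re (x.num 11).re else 1 := by
  have h21 : 2 ≠ 1 := by decide
  convert (Circuit.actsOnQubit_conjRotation O (rotEigenbasis * pauliX) 6 h21).append
    ((Circuit.actsOnQubit_cRot O 11 h21).append
      (Circuit.actsOnQubit_conjRotation O rotEigenbasis 6 h21)) using 1
  · rfl
  · funext x
    split_ifs
    · rw [rotEigenbasis_mul_pauliX_conj_rotation, rotEigenbasis_conj_rotation, twistedRotation,
        Matrix.mul_assoc]
    · simp only [Matrix.one_mul]

/-! ### Square roots and angles -/

lemma sqrt_sq (z : ℂ) : Complex.sqrt z ^ 2 = z := by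
  simp [Complex.sqrt]

lemma norm_sqrt_sq (z : ℂ) : ‖Complex.sqrt z‖ ^ 2 = ‖z‖ := by
  rw [← norm_pow, sqrt_sq]

lemma exp_arg_sqrt_sq_mul_norm_sqrt (z : ℂ) :
    Complex.exp (Complex.arg (Complex.sqrt z) * Complex.I) ^ 2 * ‖z‖ = z := by
  conv_rhs => rw [← sqrt_sq z, ← Complex.norm_mul_exp_arg_mul_I (Complex.sqrt z)]
  rw [← norm_sqrt_sq z]
  push_cast
  ring

lemma sqrt_ofReal {x : ℝ} (hx : 0 ≤ x) : Complex.sqrt x = (√x : ℝ) := by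
  rw [Complex.sqrt_of_nonneg (by exact_mod_cast hx), Complex.ofReal_re]

/-- The angle of the rotation that splits the weight `t` off the weight `S`. -/
def splitAngle (S t : ℝ) : ℝ := Real.arccos (Complex.sqrt (((S : ℂ) - t) / S)).re

section

variable {S t : ℝ}

lemma splitAngle_eq (ht : 0 ≤ t) (hS : t ≤ S) : splitAngle S t = Real.arccos √((S - t) / S) := by
  rw [splitAngle, ← Complex.ofReal_sub, ← Complex.ofReal_div,
    sqrt_ofReal (div_nonneg (by linarith) (by linarith)), Complex.ofReal_re]

lemma sqrt_mul_cos_splitAngle (ht : 0 ≤ t) (hS : t ≤ S) :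
    √S * Real.cos (splitAngle S t) = √(S - t) := by
  have hS0 : 0 ≤ S := ht.trans hS
  have hle : (S - t) / S ≤ 1 := div_le_one_of_le₀ (by linarith) hS0
  rw [splitAngle_eq ht hS, Real.cos_arccos (by linarith [Real.sqrt_nonneg ((S - t) / S)])
    (Real.sqrt_le_one.2 hle), ← Real.sqrt_mul hS0]
  rcases hS0.eq_or_lt with rfl | hpos
  · simp [le_antisymm hS ht]
  · rw [mul_div_cancel₀ _ hpos.ne']

lemma sqrt_mul_sin_splitAngle (ht : 0 ≤ t) (hS : t ≤ S) :
    √S * Real.sin (splitAngle S t) = √t := by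
  have hS0 : 0 ≤ S := ht.trans hS
  have hnonneg : 0 ≤ (S - t) / S := div_nonneg (by linarith) hS0
  rw [splitAngle_eq ht hS, Real.sin_arccos, Real.sq_sqrt hnonneg, ← Real.sqrt_mul hS0]
  rcases hS0.eq_or_lt with rfl | hpos
  · simp [le_antisymm hS ht]
  · congr 1
    field_simp
    ring

end

/-! ### The contents of the memory during the computation -/

/-- The memory during the state preparation: `x` and `y` are the contents of the two registers of
`n + 1` qubits, the index registers `2` and `3` hold the row `c` and the column `p`, the qubit `3`
holds `e`, the number registers hold `z`, and everything else is zero. -/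
def workspace (x y : Label n) (c p : Word n) (e : Bool) (z : ℕ → ℂ) : Mem n where
  idx
    | 0 => x.1
    | 1 => y.1
    | 2 => c
    | 3 => p
    | _ => 0
  bit
    | 0 => x.2
    | 1 => y.2
    | 3 => e
    | _ => false
  num := z

/-- The contents of the number registers between two steps: only the residual weight `S` is
stored. -/
def residualNums (S : ℂ) : ℕ → ℂ
  | 7 => S
  | _ => 0

/-- The contents of the number registers after looking up the entry `β` of `1 - A`, where `δ` is the
corresponding entry of `1`: the entry of `A`, then `β`, its weight, its amplitude and half of the
phase of its amplitude. -/
def entryNums (f g : UnOp) (δ β S : ℂ) : ℕ → ℂ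
  | 0 => δ - β
  | 1 => β
  | 2 => (‖β‖ : ℝ)
  | 3 => f.eval β
  | 4 => g.eval (f.eval β)
  | 5 => Complex.sqrt (g.eval (f.eval β))
  | 6 => (Complex.arg (Complex.sqrt (g.eval (f.eval β))) : ℝ)
  | 7 => S
  | _ => 0

/-- The contents of the number registers after computing the angle that splits the weight in the
register `2` off the residual weight in the register `7`. -/
def angleNums (z : ℕ → ℂ) : ℕ → ℂ
  | 8 => z 7 - z 2
  | 9 => (z 7 - z 2) / z 7
  | 10 => Complex.sqrt ((z 7 - z 2) / z 7)
  | 11 => (Real.arccos (Complex.sqrt ((z 7 - z 2) / z 7)).re : ℝ)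
  | k => z k

/-- The two basis states of the second register between which the step for the column `p` rotates:
`|0⟩|0⟩`, which holds the residual weight, and `|p⟩|1⟩`. -/
def level (p : Word n) : Bool → Label n
  | false => (0, false)
  | true => (p, true)

/-- The `ν`-th query for the row `c` returns the column `p`, and `β` is the corresponding entry of
`1 - A`. -/
structure EntryAccess (O : Oracle n) (ν : ℕ) (c p : Word n) (β : ℂ) : Prop where
  pos : O.pos (c, word n ν) = (c, p)
  val : ∀ z, O.val (c, p, z) = (c, p, z + ((if c = p then 1 else 0) - β))

/-- Looks up the `ν`-th entry of the row in the index register `2`. -/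
def lookupCircuit (f g : UnOp) (ν : ℕ) : Circuit n :=
  [.idxConst (word n ν) 3, .pos false 2 3 (by decide), .val false 2 3 0 (by decide), .idxEq 2 3 3,
    .numBit false 3 1, .numUn true .copy 0 1 (by decide), .numUn false .abs 1 2 (by decide),
    .numUn false f 1 3 (by decide), .numUn false g 3 4 (by decide),
    .numUn false .sqrt 4 5 (by decide), .numUn false .arg 5 6 (by decide)]

/-- Computes the rotation angle. -/
def angleCircuit : Circuit n :=
  [.numUn false .copy 7 8 (by decide), .numUn true .copy 2 8 (by decide),
    .numBin false .div 8 7 9 (by decide) (by decide), .numUn false .sqrt 9 10 (by decide),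
    .numUn false .arccos 10 11 (by decide)]

/-- Maps both levels to the word `0`, and flags in the qubit `2` that this has happened. -/
def alignCircuit : Circuit n := [.cIdxAdd true 1 3 1 (by decide), .idxEq 1 4 2]

/-- Rotates the plane spanned by the two levels. -/
def transferCircuit : Circuit n := alignCircuit ++ (twistedRotationCircuit ++ alignCircuit.adj)

section

variable (O : Oracle n) (x y : Label n) (c p : Word n) (e : Bool) (z : ℕ → ℂ)

lemma run_lookupCircuit {O : Oracle n} (f g : UnOp) {ν : ℕ} {c p : Word n} {β : ℂ}
    (h : EntryAccess O ν c p β) (S : ℂ) :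
    Circuit.run O (lookupCircuit f g ν) (ket (workspace x y c 0 false (residualNums S))) =
      ket (workspace x y c p (decide (c = p))
        (entryNums f g (if c = p then 1 else 0) β S)) := by
  simp only [lookupCircuit, run_cons_ket, Gate.onBasis, run_nil]
  congr 1
  ext k
  · rcases k with _ | _ | _ | _ | k <;> simp [workspace, fwdOrInv, h.pos, h.val]
  · rcases k with _ | _ | _ | _ | k <;> simp [workspace, fwdOrInv, h.pos, h.val]
  · rcases k with _ | _ | _ | _ | _ | _ | _ | _ | k <;>
      simp [workspace, fwdOrInv, h.pos, h.val, residualNums, entryNums, addOrSub, UnOp.eval]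

lemma run_angleCircuit (h8 : z 8 = 0) (h9 : z 9 = 0) (h10 : z 10 = 0) (h11 : z 11 = 0) :
    Circuit.run O angleCircuit (ket (workspace x y c p e z)) =
      ket (workspace x y c p e (angleNums z)) := by
  simp only [angleCircuit, run_cons_ket, Gate.onBasis, run_nil]
  congr 1
  ext k
  · rfl
  · rfl
  · rcases k with _ | _ | _ | _ | _ | _ | _ | _ | _ | _ | _ | _ | k <;>
      simp [workspace, angleNums, addOrSub, UnOp.eval, BinOp.eval, h8, h9, h10, h11]

lemma run_alignCircuit_level (o : Bool) :
    Circuit.run O alignCircuit (ket (workspace x (level p o) c p e z)) =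
      ket ((workspace x (0, o) c p e z).setBit 2 true) := by
  simp only [alignCircuit, run_cons_ket, Gate.onBasis, run_nil]
  congr 1
  ext k
  · rcases k with _ | _ | _ | _ | k <;> cases o <;> simp [workspace, level, addOrSub]
  · rcases k with _ | _ | _ | _ | k <;> cases o <;> simp [workspace, level, addOrSub]
  · cases o <;> rfl

lemma exists_run_alignCircuit_of_ne {y : Label n} (hy : y ≠ level p y.2) :
    ∃ x', x'.bit 2 = false ∧
      Circuit.run O alignCircuit (ket (workspace x y c p e z)) = ket x' := by
  simp only [alignCircuit, run_cons_ket, Gate.onBasis, run_nil]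
  refine ⟨_, ?_, rfl⟩
  obtain ⟨w, _ | _⟩ := y
  · simpa [workspace, level] using hy
  · simpa [workspace, level, addOrSub, sub_eq_zero] using hy

lemma phaseFree_alignCircuit : (alignCircuit : Circuit n).PhaseFree := by
  simp [Circuit.PhaseFree, alignCircuit, Gate.isPhase]

lemma run_transferCircuit_level (b : Bool) :
    Circuit.run O transferCircuit (ket (workspace x (level p b) c p e z)) =
      ∑ o, twistedRotation (z 6).re (z 11).re o b • ket (workspace x (level p o) c p e z) := by
  have hset (o : Bool) : ((workspace x (0, b) c p e z).setBit 2 true).setBit 1 o =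
      (workspace x (0, o) c p e z).setBit 2 true := by
    ext k
    · rfl
    · rcases k with _ | _ | _ | _ | k <;> simp [workspace]
    · rfl
  rw [transferCircuit, run_append, run_append, run_alignCircuit_level,
    (actsOnQubit_twistedRotationCircuit O).run_ket, applyQubit, map_sum]
  refine Finset.sum_congr rfl fun o _ => ?_
  rw [map_smul, hset, ← run_alignCircuit_level, Circuit.run_adj_run O phaseFree_alignCircuit]
  simp [workspace]

lemma run_transferCircuit_of_ne {y : Label n} (hy : y ≠ level p y.2) :
    Circuit.run O transferCircuit (ket (workspace x y c p e z)) =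
      ket (workspace x y c p e z) := by
  obtain ⟨x', hx', hrun⟩ := exists_run_alignCircuit_of_ne O x c p e z hy
  rw [transferCircuit, run_append, run_append, hrun,
    (actsOnQubit_twistedRotationCircuit O).run_ket, hx', if_neg Bool.false_ne_true,
    applyQubit_one, ← hrun, Circuit.run_adj_run O phaseFree_alignCircuit]

end

/-! ### One step of the state preparation -/

/-- Subtracts the weight of the current entry from the residual weight. -/
def spendCircuit : Circuit n := [.numUn true .copy 2 7 (by decide)]

/-- Rotates the `ν`-th entry into the superposition and updates the residual weight. -/
def stepCircuit (f g : UnOp) (ν : ℕ) : Circuit n :=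
  lookupCircuit f g ν ++ angleCircuit ++ transferCircuit ++
    (angleCircuit.adj ++ spendCircuit ++ (lookupCircuit f g ν).adj)

/-- Undoes the `ν`-th update of the residual weight. -/
def restoreCircuit (f g : UnOp) (ν : ℕ) : Circuit n :=
  lookupCircuit f g ν ++ spendCircuit.adj ++ (lookupCircuit f g ν).adj

/-- The memory between two steps, with residual weight `S` for the row `c`. -/
abbrev idle (x : Label n) (c : Word n) (S : ℝ) (y : Label n) : Mem n :=
  workspace x y c 0 false (residualNums S)

/-- The amplitude in the state to be prepared of an entry `z` of `1 - A`. The two orders in which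
`.sqrt` and `.conj` can be composed differ on the negative reals. -/
def amplitude (f g : UnOp) (z : ℂ) : ℂ := g.eval (f.eval z)

lemma phaseFree_lookupCircuit (f g : UnOp) (ν : ℕ) :
    (lookupCircuit f g ν : Circuit n).PhaseFree := by
  simp [Circuit.PhaseFree, lookupCircuit, Gate.isPhase]

lemma phaseFree_angleCircuit : (angleCircuit : Circuit n).PhaseFree := by
  simp [Circuit.PhaseFree, angleCircuit, Gate.isPhase]

lemma phaseFree_spendCircuit : (spendCircuit : Circuit n).PhaseFree := by
  simp [Circuit.PhaseFree, spendCircuit, Gate.isPhase]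

lemma run_spendCircuit (O : Oracle n) (f g : UnOp) (δ β S : ℂ) (x y : Label n) (c p : Word n)
    (e : Bool) :
    Circuit.run O spendCircuit (ket (workspace x y c p e (entryNums f g δ β S))) =
      ket (workspace x y c p e (entryNums f g δ β (S - (‖β‖ : ℝ)))) := by
  simp only [spendCircuit, run_cons_ket, Gate.onBasis, run_nil]
  congr 1
  ext k
  · rfl
  · rfl
  · rcases k with _ | _ | _ | _ | _ | _ | _ | _ | k <;>
      simp [workspace, entryNums, UnOp.eval, addOrSub]

section

variable {O : Oracle n} (f g : UnOp) {ν : ℕ} {c p : Word n} {β : ℂ}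

lemma run_angleCircuit_lookupCircuit (h : EntryAccess O ν c p β) (x y : Label n) (S : ℝ) :
    Circuit.run O (lookupCircuit f g ν ++ angleCircuit) (ket (idle x c S y)) =
      ket (workspace x y c p (decide (c = p))
        (angleNums (entryNums f g (if c = p then 1 else 0) β S))) := by
  rw [run_append, run_lookupCircuit x y f g h, run_angleCircuit _ _ _ _ _ _ _ rfl rfl rfl rfl]

lemma run_uncompute (h : EntryAccess O ν c p β) (x y : Label n) (S : ℝ) :
    Circuit.run O (angleCircuit.adj ++ spendCircuit ++ (lookupCircuit f g ν).adj)
      (ket (workspace x y c p (decide (c = p))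
        (angleNums (entryNums f g (if c = p then 1 else 0) β S)))) =
      ket (idle x c (S - ‖β‖) y) := by
  rw [run_append, run_append, ← run_angleCircuit _ _ _ _ _ _ _ rfl rfl rfl rfl,
    Circuit.run_adj_run O phaseFree_angleCircuit, run_spendCircuit, ← Complex.ofReal_sub,
    ← run_lookupCircuit x y f g h, Circuit.run_adj_run O (phaseFree_lookupCircuit f g ν)]

lemma run_stepCircuit_level (h : EntryAccess O ν c p β) (x : Label n) (S : ℝ) (b : Bool) :
    Circuit.run O (stepCircuit f g ν) (ket (idle x c S (level p b))) =
      ∑ o, twistedRotation (Complex.arg (Complex.sqrt (amplitude f g β))) (splitAngle S ‖β‖) o b •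
        ket (idle x c (S - ‖β‖) (level p o)) := by
  rw [stepCircuit, run_append O (_ ++ transferCircuit), run_append O (_ ++ angleCircuit),
    run_angleCircuit_lookupCircuit f g h,
    run_transferCircuit_level, map_sum]
  simp_rw [map_smul, run_uncompute f g h]
  rfl

lemma run_stepCircuit_of_ne (h : EntryAccess O ν c p β) (x : Label n) (S : ℝ) {y : Label n}
    (hy : y ≠ level p y.2) :
    Circuit.run O (stepCircuit f g ν) (ket (idle x c S y)) = ket (idle x c (S - ‖β‖) y) := by
  rw [stepCircuit, run_append O (_ ++ transferCircuit), run_append O (_ ++ angleCircuit),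
    run_angleCircuit_lookupCircuit f g h,
    run_transferCircuit_of_ne _ _ _ _ _ _ hy, run_uncompute f g h]

lemma run_stepCircuit_zero (h : EntryAccess O ν c p β) (hβ : ‖amplitude f g β‖ = √‖β‖)
    (x : Label n) {S : ℝ} (hS : ‖β‖ ≤ S) :
    Circuit.run O (stepCircuit f g ν) ((√S : ℂ) • ket (idle x c S (0, false))) =
      amplitude f g β • ket (idle x c (S - ‖β‖) (p, true)) +
        (√(S - ‖β‖) : ℂ) • ket (idle x c (S - ‖β‖) (0, false)) := by
  have hsin := sqrt_mul_sin_splitAngle (norm_nonneg β) hS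
  have hcos := sqrt_mul_cos_splitAngle (norm_nonneg β) hS
  rw [map_smul, show ((0, false) : Label n) = level p false from rfl, run_stepCircuit_level f g h,
    Fintype.sum_bool, smul_add, smul_smul, smul_smul, twistedRotation_true_false,
    twistedRotation_false_false, mul_left_comm, ← Complex.ofReal_sin, ← Complex.ofReal_cos,
    ← Complex.ofReal_mul, ← Complex.ofReal_mul, hsin, hcos, ← hβ, exp_arg_sqrt_sq_mul_norm_sqrt]
  rfl

lemma run_restoreCircuit (h : EntryAccess O ν c p β) (x y : Label n) (S : ℝ) :
    Circuit.run O (restoreCircuit f g ν) (ket (idle x c S y)) = ket (idle x c (S + ‖β‖) y) := by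
  have hspend :=
    run_spendCircuit O f g (if c = p then 1 else 0) β (S + ‖β‖) x y c p (decide (c = p))
  rw [add_sub_cancel_right] at hspend
  rw [restoreCircuit, run_append, run_append, run_lookupCircuit x y f g h, ← hspend,
    Circuit.run_adj_run O phaseFree_spendCircuit, ← Complex.ofReal_add,
    ← run_lookupCircuit x y f g h, Circuit.run_adj_run O (phaseFree_lookupCircuit f g ν)]

end

/-! ### The sequence of all steps -/

/-- The first `d` queries for the row `c` return the columns `p 0, p 1, …`, and `β 0, β 1, …` are
the corresponding entries of `1 - A`. -/
def RowAccess (O : Oracle n) (d : ℕ) (c : Word n) (p : ℕ → Word n) (β : ℕ → ℂ) : Prop :=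
  ∀ ν < d, EntryAccess O ν c (p ν) (β ν)

/-- The weight that is left after `k` entries. -/
def residual (β : ℕ → ℂ) (k : ℕ) : ℝ := 1 - ∑ ν ∈ Finset.range k, ‖β ν‖

/-- The superpositions of memories between two steps that differ in the second register only. -/
def idleStates (x : Label n) (c : Word n) (S : ℝ) : Submodule ℂ (State n) :=
  Submodule.span ℂ (Set.range fun y => ket (idle x c S y))

lemma word_val {i : ℕ} (h : i < 2 ^ n) : (word n i).val = i := Nat.mod_eq_of_lt h

lemma word_injOn : Set.InjOn (word n) (Set.Iio (2 ^ n)) := fun i hi j hj h => by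
  rw [← word_val hi, h, word_val hj]

lemma residual_succ (β : ℕ → ℂ) (k : ℕ) : residual β (k + 1) = residual β k - ‖β k‖ := by
  rw [residual, Finset.sum_range_succ, residual, sub_sub]

lemma ket_idle_mem (x : Label n) (c : Word n) (S : ℝ) (y : Label n) :
    ket (idle x c S y) ∈ idleStates x c S :=
  Submodule.subset_span ⟨y, rfl⟩

lemma run_stepCircuit_mem {O : Oracle n} (f g : UnOp) {ν : ℕ} {c p : Word n} {β : ℂ}
    (h : EntryAccess O ν c p β) {x : Label n} {S : ℝ} {v : State n} (hv : v ∈ idleStates x c S) :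
    Circuit.run O (stepCircuit f g ν) v ∈ idleStates x c (S - ‖β‖) := by
  refine (Submodule.span_le (p := (idleStates x c (S - ‖β‖)).comap _)).2 ?_ hv
  rintro _ ⟨y, rfl⟩
  simp only [Submodule.comap_coe, Set.mem_preimage, SetLike.mem_coe]
  by_cases hy : y = level p y.2
  · rw [hy, run_stepCircuit_level f g h]
    exact Submodule.sum_mem _ fun o _ => Submodule.smul_mem _ _ (ket_idle_mem _ _ _ _)
  · rw [run_stepCircuit_of_ne f g h x S hy]
    exact ket_idle_mem _ _ _ _

namespace RowAccess

variable {O : Oracle n} {d : ℕ} {c : Word n} {p : ℕ → Word n} {β : ℕ → ℂ}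

lemma of_succ (h : RowAccess O (d + 1) c p β) : RowAccess O d c p β :=
  fun ν hν => h ν (hν.trans d.lt_succ_self)

lemma injOn (h : RowAccess O d c p β) (hd : d ≤ 2 ^ n) : Set.InjOn p (Set.Iio d) := by
  intro ν hν ν' hν' hp
  have hpos : O.pos (c, word n ν) = O.pos (c, word n ν') := by
    rw [(h ν hν).pos, (h ν' hν').pos, hp]
  exact word_injOn (Set.Iio_subset_Iio hd hν) (Set.Iio_subset_Iio hd hν')
    (Prod.ext_iff.1 (O.pos.injective hpos)).2

lemma run_steps_mem (h : RowAccess O d c p β) (f g : UnOp) (x y : Label n) :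
    Circuit.run O ((List.range d).flatMap (stepCircuit f g)) (ket (idle x c 1 y)) ∈
      idleStates x c (residual β d) := by
  induction d with
  | zero => simpa [residual] using ket_idle_mem x c 1 y
  | succ d ih =>
    rw [List.range_succ, List.flatMap_append, List.flatMap_singleton, run_append, residual_succ]
    exact run_stepCircuit_mem f g (h d d.lt_succ_self) (ih h.of_succ)

lemma run_steps_zero (h : RowAccess O d c p β) (hp : Set.InjOn p (Set.Iio d)) {f g : UnOp}
    (hfg : ∀ z, ‖amplitude f g z‖ = √‖z‖) (hres : 0 ≤ residual β d) (x : Label n) :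
    Circuit.run O ((List.range d).flatMap (stepCircuit f g)) (ket (idle x c 1 (0, false))) =
      ∑ ν ∈ Finset.range d, amplitude f g (β ν) • ket (idle x c (residual β d) (p ν, true)) +
        (√(residual β d) : ℂ) • ket (idle x c (residual β d) (0, false)) := by
  induction d with
  | zero => simp [residual]
  | succ d ih =>
    have hlast : ‖β d‖ ≤ residual β d := by rwa [residual_succ, sub_nonneg] at hres
    have hother (ν) (hν : ν ∈ Finset.range d) : ((p ν, true) : Label n) ≠ level (p d) true := by
      intro heq
      have hν' := Finset.mem_range.1 hν
      exact hν'.ne (hp (hν'.trans d.lt_succ_self) d.lt_succ_self (congrArg Prod.fst heq))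
    rw [List.range_succ, List.flatMap_append, List.flatMap_singleton, run_append,
      ih h.of_succ (hp.mono (Set.Iio_subset_Iio d.le_succ)) ((norm_nonneg _).trans hlast), map_add,
      run_stepCircuit_zero f g (h d d.lt_succ_self) (hfg _) x hlast, ← residual_succ, ← add_assoc,
      Finset.sum_range_succ, map_sum]
    refine congrArg (· + _ + _) (Finset.sum_congr rfl fun ν hν => ?_)
    rw [map_smul, run_stepCircuit_of_ne f g (h d d.lt_succ_self) x _ (hother ν hν), residual_succ]

lemma run_restores (h : RowAccess O d c p β) (f g : UnOp) (x : Label n) (S : ℝ) (y : Label n) :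
    Circuit.run O ((List.range d).flatMap (restoreCircuit f g)) (ket (idle x c S y)) =
      ket (idle x c (S + ∑ ν ∈ Finset.range d, ‖β ν‖) y) := by
  induction d with
  | zero => simp
  | succ d ih =>
    rw [List.range_succ, List.flatMap_append, List.flatMap_singleton, run_append, ih h.of_succ,
      run_restoreCircuit f g (h d d.lt_succ_self), Finset.sum_range_succ, add_assoc]

end RowAccess

/-! ### The state preparation circuit -/

/-- The word `i` if it is a label, and the label `0` otherwise. -/
def clamp (N : ℕ) (i : Word n) : Word n := if word n (N - 1) < i then 0 else i

/-- Computes the clamped label in the index register `2`, and initialises the residual weight. -/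
def clampCircuit (N : ℕ) : Circuit n :=
  [.idxConst (word n (N - 1)) 3, .idxLt 3 0 2, .idxAdd false 0 2 (by decide),
    .cIdxAdd true 2 0 2 (by decide), .idxLt 3 0 2, .idxConst (-word n (N - 1)) 3, .numConst 1 7]

/-- Clears everything but the two registers after the last step, and renames `|l⟩|1⟩` to
`label n l` and `|0⟩|0⟩` to `lastLabel n`. -/
def finishCircuit (N d : ℕ) (f g : UnOp) : Circuit n :=
  (List.range d).flatMap (restoreCircuit f g) ++ (clampCircuit N).adj ++ [.single 1 pauliX]

/-- Prepares, in the second register, the state given by the row in the first register. -/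
def rowCircuit (N d : ℕ) (f g : UnOp) : Circuit n :=
  clampCircuit N ++ ((List.range d).flatMap (stepCircuit f g) ++ finishCircuit N d f g)

lemma load_eq_idle (a : Bool) (y : Label n) (i : Word n) :
    load ((a, y), i) = idle (i, a) 0 0 y := by
  have hword : word n 0 = 0 := rfl
  ext k
  · rcases k with _ | _ | _ | _ | k <;> simp [load, workspace, reg₁, reg₂, hword]
  · rcases k with _ | _ | _ | _ | k <;> simp [load, workspace, reg₁, reg₂]
  · rcases k with _ | _ | _ | _ | _ | _ | _ | _ | k <;> simp [load, workspace, residualNums]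

lemma run_clampCircuit (O : Oracle n) (N : ℕ) (x y : Label n) :
    Circuit.run O (clampCircuit N) (ket (idle x 0 0 y)) = ket (idle x (clamp N x.1) 1 y) := by
  simp only [clampCircuit, run_cons_ket, Gate.onBasis, run_nil]
  congr 1
  by_cases h : word n (N - 1) < x.1 <;> ext k
  · rcases k with _ | _ | _ | _ | k <;> simp [workspace, addOrSub, clamp, h]
  · rcases k with _ | _ | _ | _ | k <;> simp [workspace, h]
  · rcases k with _ | _ | _ | _ | _ | _ | _ | _ | k <;> simp [workspace, residualNums, h]
  · rcases k with _ | _ | _ | _ | k <;> simp [workspace, addOrSub, clamp, h]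
  · rcases k with _ | _ | _ | _ | k <;> simp [workspace, h]
  · rcases k with _ | _ | _ | _ | _ | _ | _ | _ | k <;> simp [workspace, residualNums, h]

lemma run_single_pauliX (O : Oracle n) (x y : Label n) (c : Word n) (S : ℝ) :
    Circuit.run O [.single 1 pauliX] (ket (idle x c S y)) = ket (idle x c S (y.1, !y.2)) := by
  have hset (o : Bool) : (idle x c S y).setBit 1 o = idle x c S (y.1, o) := by
    ext k
    · rfl
    · rcases k with _ | _ | _ | _ | k <;> simp [workspace]
    · rfl
  have hbit : (idle x c S y).bit 1 = y.2 := rfl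
  simp only [run_cons_ket, run_nil, Gate.onBasis, applyQubit, hset, hbit]
  obtain ⟨w, _ | _⟩ := y <;> simp [pauliX]

lemma phaseFree_clampCircuit (N : ℕ) : (clampCircuit N : Circuit n).PhaseFree := by
  simp [Circuit.PhaseFree, clampCircuit, Gate.isPhase]

section

variable {O : Oracle n} {N d : ℕ} {i : Word n} {p : ℕ → Word n} {β : ℕ → ℂ}

lemma run_finishCircuit (h : RowAccess O d (clamp N i) p β) (f g : UnOp) (a : Bool)
    (y : Label n) :
    Circuit.run O (finishCircuit N d f g) (ket (idle (i, a) (clamp N i) (residual β d) y)) =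
      ket (load ((a, y.1, !y.2), i)) := by
  rw [finishCircuit, run_append, run_append, h.run_restores, residual, sub_add_cancel,
    ← run_clampCircuit O N (i, a), Circuit.run_adj_run O (phaseFree_clampCircuit N),
    run_single_pauliX, load_eq_idle]

lemma run_rowCircuit_mem (h : RowAccess O d (clamp N i) p β) (f g : UnOp) (a : Bool)
    (y : Label n) :
    Circuit.run O (rowCircuit N d f g) (ket (load ((a, y), i))) ∈
      LinearMap.range (loadState n) := by
  rw [rowCircuit, run_append, run_append, load_eq_idle, run_clampCircuit]
  refine (Submodule.span_le (p := (LinearMap.range (loadState n)).comap _)).2 ?_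
    (h.run_steps_mem f g (i, a) y)
  rintro _ ⟨y, rfl⟩
  rw [SetLike.mem_coe, Submodule.mem_comap, run_finishCircuit h]
  exact ⟨_, loadState_single _⟩

lemma run_rowCircuit_zero (h : RowAccess O d (clamp N i) p β) (hd : d ≤ 2 ^ n) {f g : UnOp}
    (hfg : ∀ z, ‖amplitude f g z‖ = √‖z‖) (hres : 0 ≤ residual β d) :
    Circuit.run O (rowCircuit N d f g) (ket (load (ancZero n, i))) =
      ∑ ν ∈ Finset.range d, amplitude f g (β ν) • ket (load ((false, p ν, false), i)) +
        (√(residual β d) : ℂ) • ket (load ((false, lastLabel n), i)) := by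
  rw [rowCircuit, run_append, run_append, ancZero, load_eq_idle, run_clampCircuit,
    show word n 0 = 0 from rfl, h.run_steps_zero (h.injOn hd) hfg hres, map_add, map_sum]
  simp only [map_smul, run_finishCircuit h]
  rfl

end

/-! ### Costs -/

lemma phaseFree_transferCircuit : (transferCircuit : Circuit n).PhaseFree := by
  refine phaseFree_alignCircuit.append (.append ?_ (Circuit.phaseFree_adj _))
  simp [Circuit.PhaseFree, twistedRotationCircuit, Circuit.conjRotation, Gate.isPhase]

lemma phaseFree_stepCircuit (f g : UnOp) (ν : ℕ) : (stepCircuit f g ν : Circuit n).PhaseFree :=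
  (((phaseFree_lookupCircuit f g ν).append phaseFree_angleCircuit).append
    phaseFree_transferCircuit).append
      (((Circuit.phaseFree_adj _).append phaseFree_spendCircuit).append (Circuit.phaseFree_adj _))

lemma phaseFree_restoreCircuit (f g : UnOp) (ν : ℕ) :
    (restoreCircuit f g ν : Circuit n).PhaseFree :=
  ((phaseFree_lookupCircuit f g ν).append (Circuit.phaseFree_adj _)).append
    (Circuit.phaseFree_adj _)

lemma phaseFree_rowCircuit (N d : ℕ) (f g : UnOp) : (rowCircuit N d f g : Circuit n).PhaseFree :=
  (phaseFree_clampCircuit N).append <|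
    (Circuit.PhaseFree.flatMap (phaseFree_stepCircuit f g) _).append <|
      ((Circuit.PhaseFree.flatMap (phaseFree_restoreCircuit f g) _).append
        (Circuit.phaseFree_adj _)).append (by simp [Circuit.PhaseFree, Gate.isPhase])

lemma length_flatMap_range_le {F : ℕ → Circuit n} {b : ℕ} (hF : ∀ ν, (F ν).length ≤ b) (d : ℕ) :
    ((List.range d).flatMap F).length ≤ b * d := by
  induction d with
  | zero => simp
  | succ d ih =>
    rw [List.range_succ, List.flatMap_append, List.flatMap_singleton, List.length_append, mul_add,
      mul_one]
    exact add_le_add ih (hF d)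

lemma length_stepCircuit_le (f g : UnOp) (ν : ℕ) :
    (stepCircuit f g ν : Circuit n).length ≤ 80 := by
  have halign := Circuit.length_adj_le (alignCircuit : Circuit n)
  have hangle := Circuit.length_adj_le (angleCircuit : Circuit n)
  have hlookup := Circuit.length_adj_le (lookupCircuit f g ν : Circuit n)
  rw [stepCircuit, transferCircuit, twistedRotationCircuit, Circuit.conjRotation,
    Circuit.conjRotation]
  simp only [List.length_append]
  simp only [lookupCircuit, angleCircuit, alignCircuit, spendCircuit, List.length_cons,
    List.length_nil] at *
  lia

lemma length_restoreCircuit_le (f g : UnOp) (ν : ℕ) :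
    (restoreCircuit f g ν : Circuit n).length ≤ 47 := by
  have hspend := Circuit.length_adj_le (spendCircuit : Circuit n)
  have hlookup := Circuit.length_adj_le (lookupCircuit f g ν : Circuit n)
  rw [restoreCircuit, List.length_append, List.length_append]
  simp only [lookupCircuit, spendCircuit, List.length_cons, List.length_nil] at *
  lia

lemma length_rowCircuit_le (N d : ℕ) (f g : UnOp) :
    (rowCircuit N d f g : Circuit n).length ≤ 127 * d + 29 := by
  have hsteps := length_flatMap_range_le (n := n) (length_stepCircuit_le f g) d
  have hrestores := length_flatMap_range_le (n := n) (length_restoreCircuit_le f g) d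
  have hclamp := Circuit.length_adj_le (clampCircuit N : Circuit n)
  rw [rowCircuit, finishCircuit]
  simp only [List.length_append]
  simp only [clampCircuit, List.length_cons, List.length_nil] at *
  lia

/-! ### Exchanging the two registers -/

/-- Exchanges the two registers of `n + 1` qubits. -/
def swapCircuit : Circuit n :=
  [.idxSwap 0 1, .cnot 0 1 (by decide), .cnot 1 0 (by decide), .cnot 0 1 (by decide)]

/-- The exchange of the two registers on basis states. -/
def swapRegs : Equiv.Perm (Anc n × Word n) where
  toFun x := ((x.1.2.2, x.2, x.1.1), x.1.2.1)
  invFun x := ((x.1.2.2, x.2, x.1.1), x.1.2.1)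
  left_inv _ := rfl
  right_inv _ := rfl

lemma run_swapCircuit (O : Oracle n) (x : Anc n × Word n) :
    Circuit.run O swapCircuit (ket (load x)) = ket (load (swapRegs x)) := by
  obtain ⟨⟨a, w, b⟩, i⟩ := x
  simp only [swapCircuit, run_cons_ket, Gate.onBasis, run_nil]
  congr 1
  ext k
  · rcases k with _ | _ | k <;> simp [load, reg₁, reg₂, swapRegs]
  · rcases k with _ | _ | k <;> cases a <;> cases b <;> simp [load, reg₁, reg₂, swapRegs]
  · rfl

lemma Implements.append_swapCircuit {O : Oracle n} {c : Circuit n}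
    {U : Matrix (Anc n × Word n) (Anc n × Word n) ℂ} (h : Implements O c U) :
    Implements O (c ++ swapCircuit) (U.submatrix swapRegs id) := fun x => by
  rw [run_append, h x, map_sum, ← Equiv.sum_comp swapRegs]
  simp only [map_smul, run_swapCircuit, Matrix.submatrix_apply, id]
  rfl

/-! ### The rows of `1 - A` -/

lemma word_fin_injective {N : ℕ} (hN : N ≤ 2 ^ n) : Function.Injective fun i : Fin N => word n i :=
  fun i j h => Fin.ext (word_injOn (i.2.trans_le hN) (j.2.trans_le hN) h)

/-- The label stored in a word, or `0` if the word is not a label. -/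
def rowOf (N : ℕ) [NeZero N] (i : Word n) : Fin N := if h : i.val < N then ⟨i, h⟩ else 0

lemma rowOf_word {N : ℕ} [NeZero N] (hN : N ≤ 2 ^ n) (i : Fin N) : rowOf N (word n i) = i := by
  simp [rowOf, word_val (i.2.trans_le hN)]

lemma clamp_eq_word_rowOf {N : ℕ} [NeZero N] (hN : N ≤ 2 ^ n) (i : Word n) :
    clamp N i = word n (rowOf N i) := by
  have hN0 : 0 < N := NeZero.pos N
  have hlt : word n (N - 1) < i ↔ ¬ i.val < N := by
    rw [Fin.lt_def, word_val (by lia)]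
    lia
  by_cases h : i.val < N
  · rw [clamp, if_neg (by simpa [hlt] using h), rowOf, dif_pos h]
    exact Fin.ext (word_val i.2).symm
  · rw [clamp, if_pos (hlt.2 h), rowOf, dif_neg h]
    rfl

/-- The state with the amplitudes `a (B r l)` on the labels, in which the last label carries the
remaining weight. -/
def rowState {N : ℕ} (n : ℕ) (a : ℂ → ℂ) (B : Matrix (Fin N) (Fin N) ℂ) (r : Fin N) :
    Label n → ℂ :=
  ∑ l, a (B r l) • Pi.single (label n l) 1 +
    (√(1 - ∑ l, ‖B r l‖) : ℂ) • Pi.single (lastLabel n) 1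

section

variable {N : ℕ} {A B : Matrix (Fin N) (Fin N) ℂ}

lemma rowState_label (hN : N ≤ 2 ^ n) (a : ℂ → ℂ) (r l : Fin N) :
    rowState n a B r (label n l) = a (B r l) := by
  have hlabel (k : Fin N) : label n l = label n k ↔ k = l := by
    simp only [label, Prod.mk.injEq, and_true, (word_fin_injective hN).eq_iff, eq_comm]
  have hlast : label n l ≠ lastLabel n := by simp [label, lastLabel]
  simp [rowState, Pi.single_apply, hlabel, hlast]

lemma rowState_of_le (hN : N ≤ 2 ^ n) (a : ℂ → ℂ) (r : Fin N) {w : Word n} (hw : N ≤ w.val) :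
    rowState n a B r (w, false) = 0 := by
  have hlabel (k : Fin N) : ((w, false) : Label n) ≠ label n k := fun h => by
    have hk : w.val = k := (congrArg (fun y : Label n => y.1.val) h).trans
      (word_val (k.2.trans_le hN))
    exact (hk ▸ hw).not_gt k.2
  have hlast : ((w, false) : Label n) ≠ lastLabel n := by simp [lastLabel]
  simp [rowState, hlabel, hlast]

lemma norm_amplitude_sqrt_conj (z : ℂ) : ‖amplitude .sqrt .conj z‖ = √‖z‖ := by
  rw [amplitude, UnOp.eval, UnOp.eval, RCLike.norm_conj, ← norm_sqrt_sq z,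
    Real.sqrt_sq (norm_nonneg _)]

lemma norm_amplitude_conj_sqrt (z : ℂ) : ‖amplitude .conj .sqrt z‖ = √‖z‖ := by
  rw [amplitude, UnOp.eval, UnOp.eval, ← RCLike.norm_conj z, ← norm_sqrt_sq ((starRingEnd ℂ) z),
    Real.sqrt_sq (norm_nonneg _)]

lemma coe_re_diag (hA : A.IsHermitian) (r : Fin N) : ((A r r).re : ℂ) = A r r :=
  hA.coe_re_apply_self r

lemma rest_eq_one_sub_sum (hA : A.IsHermitian) {r : Fin N} (hle : (A r r).re ≤ 1) :
    rest A r = 1 - ∑ l, ‖(1 - A) r l‖ := by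
  have hdiag : ‖(1 - A) r r‖ = 1 - (A r r).re := by
    rw [Matrix.sub_apply, Matrix.one_apply_eq, ← coe_re_diag hA, ← Complex.ofReal_one,
      ← Complex.ofReal_sub, Complex.norm_of_nonneg (sub_nonneg.2 hle), Complex.ofReal_re]
  have hoff : ∑ l ∈ Finset.univ.erase r, ‖(1 - A) r l‖ = ∑ l ∈ Finset.univ.erase r, ‖A r l‖ :=
    Finset.sum_congr rfl fun l hl => by
      rw [Matrix.sub_apply, Matrix.one_apply_ne (Finset.ne_of_mem_erase hl).symm, zero_sub,
        norm_neg]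
  rw [← Finset.add_sum_erase _ _ (Finset.mem_univ r), hdiag, hoff, rest]
  ring

lemma rest_nonneg (hA : A.IsHermitian) (hdom : IsDiagDominant A) {r : Fin N}
    (hr : 0 ≤ (A r r).re) : 0 ≤ rest A r := by
  have hnorm : ‖A r r‖ = (A r r).re := by
    rw [← coe_re_diag hA, Complex.norm_of_nonneg hr, Complex.ofReal_re]
  exact sub_nonneg.2 (hnorm ▸ hdom r)

lemma one_sub_apply_eq_zero {r l : Fin N} (hr : A r r ≠ 0) (hl : A r l = 0) :
    (1 - A) r l = 0 := by
  have hne : r ≠ l := by rintro rfl; exact hr hl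
  rw [Matrix.sub_apply, Matrix.one_apply_ne hne, hl, sub_zero]

open Classical in
lemma rowState_one_sub (hA : A.IsHermitian) {r : Fin N} (hr : A r r ≠ 0) (hle : (A r r).re ≤ 1)
    {a : ℂ → ℂ} (ha : a 0 = 0) :
    rowState n a (1 - A) r =
      ∑ l with A r l ≠ 0, a ((if r = l then 1 else 0) - A r l) • Pi.single (label n l) 1 +
        (√(rest A r) : ℂ) • Pi.single (lastLabel n) 1 := by
  rw [rowState, rest_eq_one_sub_sum hA hle, Finset.sum_filter_of_ne]
  · simp only [Matrix.sub_apply, Matrix.one_apply]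
  · intro l _ hl h0
    rw [← Matrix.one_apply, ← Matrix.sub_apply, one_sub_apply_eq_zero hr h0, ha, zero_smul] at hl
    exact hl rfl

lemma conj_psi (hA : A.IsHermitian) {r : Fin N} (hr : A r r ≠ 0) (hle : (A r r).re ≤ 1)
    (y : Label n) :
    (starRingEnd ℂ) (psi n A r y) = rowState n (amplitude .sqrt .conj) (1 - A) r y := by
  rw [rowState_one_sub hA hr hle (by simp [amplitude, UnOp.eval])]
  simp only [psi, Pi.add_apply, Finset.sum_apply, Pi.smul_apply, smul_eq_mul, map_add, map_sum,
    map_mul, amplitude, UnOp.eval, Complex.conj_ofReal, Pi.single_apply, apply_ite (starRingEnd ℂ),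
    map_one, map_zero]

lemma phi_eq_rowState (hA : A.IsHermitian) {r : Fin N} (hr : A r r ≠ 0) (hle : (A r r).re ≤ 1) :
    phi n A r = rowState n (amplitude .conj .sqrt) (1 - A) r := by
  rw [rowState_one_sub hA hr hle (by simp [amplitude, UnOp.eval])]
  simp only [phi, amplitude, UnOp.eval, map_sub, apply_ite (starRingEnd ℂ), map_one, map_zero]

end

/-! ### The state preparation unitary -/

/-- The state `v` of the second register next to the row `i` in the first register. -/
def besideRow (i : Word n) : (Label n → ℂ) →ₗ[ℂ] State n :=
  Fintype.linearCombination ℂ fun y => ket (load ((false, y), i))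

/-- On every word `i`, including those that are not labels, `U` maps `|0⟩|i⟩` to `|i⟩|ξ i⟩`. -/
def PreparesRows (ξ : Word n → Label n → ℂ) (U : Matrix (Anc n × Word n) (Anc n × Word n) ℂ) :
    Prop :=
  ∀ i y, U y (ancZero n, i) = (if reg₁ y = (i, false) then 1 else 0) * ξ i (reg₂ y)

open Classical in
lemma besideRow_single (i : Word n) (y : Label n) :
    besideRow i (Pi.single y 1) = ket (load ((false, y), i)) := by
  simp [besideRow, Fintype.linearCombination_apply_single]

lemma besideRow_apply_load (i : Word n) (v : Label n → ℂ) (y : Anc n × Word n) :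
    besideRow i v (load y) = (if reg₁ y = (i, false) then 1 else 0) * v (reg₂ y) := by
  classical
  obtain ⟨⟨b, y⟩, k⟩ := y
  have hiff (y' : Label n) :
      ((false, y'), i) = ((b, y), k) ↔ reg₁ ((b, y), k) = (i, false) ∧ y = y' := by
    simp only [reg₁, Prod.mk.injEq]
    tauto
  simp only [besideRow, Fintype.linearCombination_apply, Finsupp.finsetSum_apply,
    Finsupp.smul_apply, ket, Finsupp.single_apply, load_injective.eq_iff, hiff, ite_and,
    smul_eq_mul]
  split_ifs <;> simp [reg₂]

section

variable {N d : ℕ} {A : Matrix (Fin N) (Fin N) ℂ} {O : Oracle n}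

lemma IsSparseAccess.exists_rowAccess [NeZero N] (hN : N ≤ 2 ^ n)
    (hO : IsSparseAccess O A d) (r : Fin N) :
    ∃ J : ℕ → Fin N,
      RowAccess O d (word n r) (fun ν => word n (J ν)) (fun ν => (1 - A) r (J ν)) ∧
        ∀ l, A r l ≠ 0 → ∃ ν < d, J ν = l := by
  obtain ⟨⟨j, hj, hsupp⟩, hval⟩ := hO
  refine ⟨fun ν => if hν : ν < d then j r ⟨ν, hν⟩ else 0, fun ν hν => ⟨?_, fun z => ?_⟩,
    fun l hl => ?_⟩
  · simpa [hν] using hj r ⟨ν, hν⟩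
  · simp [hν, hval, Matrix.one_apply, (word_fin_injective hN).eq_iff]
  · obtain ⟨ν, rfl⟩ := hsupp r l hl
    exact ⟨ν, ν.2, by simp⟩

lemma sum_range_comp_eq_sum {M : Type*} [AddCommMonoid M] {J : ℕ → Fin N}
    (hJ : Set.InjOn J (Set.Iio d)) {F : Fin N → M} (hF : ∀ l, F l ≠ 0 → ∃ ν < d, J ν = l) :
    ∑ ν ∈ Finset.range d, F (J ν) = ∑ l, F l :=
  Finset.sum_of_injOn J (by simpa using hJ) (by simp)
    (fun l _ hl => by_contra fun h => hl (by simpa using hF l h)) fun _ _ => rfl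

lemma run_rowCircuit_eq_besideRow {i : Word n} {r : Fin N} {J : ℕ → Fin N}
    (h : RowAccess O d (clamp N i) (fun ν => word n (J ν)) (fun ν => (1 - A) r (J ν)))
    (hsupp : ∀ l, A r l ≠ 0 → ∃ ν < d, J ν = l) (hd : d ≤ 2 ^ n) (hr : A r r ≠ 0)
    (hsum : ∑ l, ‖(1 - A) r l‖ ≤ 1) {f g : UnOp} (hfg : ∀ z, ‖amplitude f g z‖ = √‖z‖) :
    Circuit.run O (rowCircuit N d f g) (ket (load (ancZero n, i))) =
      besideRow i (rowState n (amplitude f g) (1 - A) r) := by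
  classical
  have hJ : Set.InjOn J (Set.Iio d) := fun ν hν ν' hν' hνν' =>
    h.injOn hd hν hν' (congrArg (fun l : Fin N => word n l) hνν')
  have hsupp' (l) (hl : (1 - A) r l ≠ 0) : ∃ ν < d, J ν = l :=
    hsupp l fun h0 => hl (one_sub_apply_eq_zero hr h0)
  have hamp : amplitude f g 0 = 0 := by simpa using hfg 0
  have hres : residual (fun ν => (1 - A) r (J ν)) d = 1 - ∑ l, ‖(1 - A) r l‖ := by
    rw [residual, sum_range_comp_eq_sum hJ (F := fun l => ‖(1 - A) r l‖)
      fun l hl => hsupp' l (norm_ne_zero_iff.1 hl)]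
  have hket := sum_range_comp_eq_sum hJ
    (F := fun l => amplitude f g ((1 - A) r l) • ket (load ((false, label n l), i)))
    fun l hl => hsupp' l fun h0 => hl (by rw [h0, hamp, zero_smul])
  rw [run_rowCircuit_zero h hd hfg (by rw [hres]; exact sub_nonneg.2 hsum), hres, rowState,
    map_add, map_sum]
  simp only [map_smul, besideRow_single]
  exact congrArg (· + _) hket

theorem exists_preparesRows [NeZero N] (hN : N ≤ 2 ^ n) (hd : d ≤ 2 ^ n) (hA : A.IsHermitian)
    (hpos : ∀ r, 0 < (A r r).re) (hdom : IsDiagDominant A) (hle : ∀ r, (A r r).re ≤ 1)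
    (hO : IsSparseAccess O A d) {f g : UnOp} (hfg : ∀ z, ‖amplitude f g z‖ = √‖z‖) :
    ∃ U, Implements O (rowCircuit N d f g) U ∧
      PreparesRows (fun i => rowState n (amplitude f g) (1 - A) (rowOf N i)) U := by
  have hrow (i : Word n) := clamp_eq_word_rowOf hN i ▸ hO.exists_rowAccess hN (rowOf N i)
  choose J hJ hsupp using hrow
  obtain ⟨U, hU⟩ := exists_implements fun ⟨⟨a, y⟩, i⟩ => run_rowCircuit_mem (hJ i) f g a y
  refine ⟨U, hU, fun i y => ?_⟩
  have hr := hpos (rowOf N i)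
  have hne : A (rowOf N i) (rowOf N i) ≠ 0 := fun h => by simp [h] at hr
  have hsum := rest_nonneg hA hdom hr.le
  rw [rest_eq_one_sub_sum hA (hle _), sub_nonneg] at hsum
  rw [hU.apply_eq, run_rowCircuit_eq_besideRow (hJ i) (hsupp i) hd hne hsum hfg,
    besideRow_apply_load]

end

/-! ### The block-encoding -/

section

variable {UL UR : Matrix (Anc n × Word n) (Anc n × Word n) ℂ} {ξ η : Word n → Label n → ℂ}

lemma PreparesRows.conjTranspose_mul_submatrix_swapRegs (hL : PreparesRows ξ UL)
    (hR : PreparesRows η UR) (i j : Word n) :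
    (ULᴴ * UR.submatrix swapRegs id) (ancZero n, i) (ancZero n, j) =
      (starRingEnd ℂ) (ξ i (j, false)) * η j (i, false) := by
  rw [Matrix.mul_apply, Finset.sum_eq_single ((false, j, false), i)]
  · rw [Matrix.conjTranspose_apply, hL, Matrix.submatrix_apply, id, hR]
    simp [reg₁, reg₂, swapRegs]
  · rintro ⟨⟨b, y⟩, k⟩ - hne
    rw [Matrix.conjTranspose_apply, hL, Matrix.submatrix_apply, id, hR]
    by_cases h₁ : (k, b) = (i, false)
    · have h₂ : y ≠ (j, false) := by rintro rfl; simp_all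
      simp [reg₁, swapRegs, h₂]
    · simp [reg₁, h₁]
  · simp

lemma isBlockEncoding_of_apply_eq {U : Matrix (Anc n × Word n) (Anc n × Word n) ℂ}
    {M : Matrix (Word n) (Word n) ℂ} (hU : U ∈ Matrix.unitaryGroup (Anc n × Word n) ℂ)
    (hM : ∀ i j, U (ancZero n, i) (ancZero n, j) = M i j) :
    IsBlockEncoding 1 (n + 2) 0 (ancZero n) U M := by
  refine ⟨?_, hU, ?_⟩
  · simp only [Fintype.card_prod, Fintype.card_bool, Fintype.card_fin]
    ring
  · have hblock : Matrix.of (fun i j => U (ancZero n, i) (ancZero n, j)) = M := Matrix.ext hM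
    simp [hblock]

end

section

variable {N : ℕ} [NeZero N] {B : Matrix (Fin N) (Fin N) ℂ}

lemma conj_rowState_mul_rowState (hN : N ≤ 2 ^ n) (hB : B.IsHermitian) (i j : Word n) :
    (starRingEnd ℂ) (rowState n (amplitude .sqrt .conj) B (rowOf N i) (j, false)) *
      rowState n (amplitude .conj .sqrt) B (rowOf N j) (i, false) = padded n B i j := by
  by_cases hi : i.val < N
  · by_cases hj : j.val < N
    · obtain ⟨r, rfl⟩ : ∃ r : Fin N, i = word n r := ⟨⟨i, hi⟩, Fin.ext (word_val i.2).symm⟩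
      obtain ⟨s, rfl⟩ : ∃ s : Fin N, j = word n s := ⟨⟨j, hj⟩, Fin.ext (word_val j.2).symm⟩
      have hconj : (starRingEnd ℂ) (B s r) = B r s := hB.apply r s
      rw [rowOf_word hN, rowOf_word hN, ← label, ← label, rowState_label hN, rowState_label hN]
      simp [amplitude, UnOp.eval, hconj, ← sq, sqrt_sq, padded, word_val, r.2.trans_le hN,
        s.2.trans_le hN]
    · rw [rowState_of_le hN _ _ (not_lt.1 hj), map_zero, zero_mul, padded, Matrix.of_apply,
        dif_neg (not_and_of_not_right _ hj)]
  · rw [rowState_of_le hN _ (rowOf N j) (not_lt.1 hi), mul_zero, padded, Matrix.of_apply,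
      dif_neg (not_and_of_not_left _ hi)]

end

section

variable {N : ℕ} {A : Matrix (Fin N) (Fin N) ℂ} {U : Matrix (Anc n × Word n) (Anc n × Word n) ℂ}

lemma preparesLeft_of_preparesRows [NeZero N] (hN : N ≤ 2 ^ n) (hA : A.IsHermitian)
    (hne : ∀ r, A r r ≠ 0) (hle : ∀ r, (A r r).re ≤ 1)
    (hU : PreparesRows (fun i => rowState n (amplitude .sqrt .conj) (1 - A) (rowOf N i)) U) :
    PreparesLeft A U := fun r y => by
  rw [hU]
  beta_reduce
  rw [rowOf_word hN, conj_psi hA (hne r) (hle r)]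
  rfl

lemma preparesRight_of_preparesRows [NeZero N] (hN : N ≤ 2 ^ n) (hA : A.IsHermitian)
    (hne : ∀ r, A r r ≠ 0) (hle : ∀ r, (A r r).re ≤ 1)
    (hU : PreparesRows (fun i => rowState n (amplitude .conj .sqrt) (1 - A) (rowOf N i)) U) :
    PreparesRight A (U.submatrix swapRegs id) := fun r y => by
  rw [Matrix.submatrix_apply, id, hU]
  beta_reduce
  rw [rowOf_word hN, ← phi_eq_rowState hA (hne r) (hle r), mul_comm]
  rfl

end

/-! ### The circuits of the proposition -/

/-- Prepares `|i⟩|ψ_i^*⟩` from `|0⟩|i⟩`. -/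
def leftCircuit (N d : ℕ) : Circuit n := rowCircuit N d .sqrt .conj

/-- Prepares `|φ_j⟩|j⟩` from `|0⟩|j⟩`. -/
def rightCircuit (N d : ℕ) : Circuit n := rowCircuit N d .conj .sqrt ++ swapCircuit

/-- Block-encodes `1 - A`, as `U_L† U_R`. -/
def blockCircuit (N d : ℕ) : Circuit n := rightCircuit N d ++ (leftCircuit N d).adj

lemma Circuit.queries_le_and_gates_le {c : Circuit n} {k : ℕ} (hc : c.length ≤ k) :
    c.queries ≤ k ∧ c.gates ≤ k :=
  ⟨List.countP_le_length.trans hc, List.countP_le_length.trans hc⟩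

lemma cost_le {N d : ℕ} (hd : 0 < d) :
    ∀ c ∈ [(leftCircuit N d : Circuit n), rightCircuit N d, blockCircuit N d],
      c.queries ≤ 628 * d ∧ c.gates ≤ 628 * d := by
  have hleft : (leftCircuit N d : Circuit n).length ≤ 127 * d + 29 := length_rowCircuit_le ..
  have hright : (rightCircuit N d : Circuit n).length ≤ 127 * d + 33 := by
    rw [rightCircuit, List.length_append]
    exact Nat.add_le_add_right (length_rowCircuit_le N d .conj .sqrt) 4
  have hadj := (leftCircuit N d : Circuit n).length_adj_le
  have hblock : (blockCircuit N d : Circuit n).length ≤ 628 * d := by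
    rw [blockCircuit, List.length_append]
    lia
  simp only [List.mem_cons, List.not_mem_nil, or_false, forall_eq_or_imp, forall_eq]
  exact ⟨Circuit.queries_le_and_gates_le (by lia), Circuit.queries_le_and_gates_le (by lia),
    Circuit.queries_le_and_gates_le hblock⟩

section

variable {N d : ℕ} {A : Matrix (Fin N) (Fin N) ℂ} {O : Oracle n}

lemma IsSparseAccess.pos_of_apply_ne_zero (hO : IsSparseAccess O A d) {r l : Fin N}
    (h : A r l ≠ 0) : 0 < d := by
  obtain ⟨⟨j, -, hsupp⟩, -⟩ := hO
  obtain ⟨ν, -⟩ := hsupp r l h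
  exact ν.pos

theorem exists_implements_circuits [NeZero N] (hN : N ≤ 2 ^ n) (hd : d ≤ 2 ^ n)
    (hA : A.IsHermitian) (hpos : ∀ r, 0 < (A r r).re) (hdom : IsDiagDominant A)
    (hle : ∀ r, (A r r).re ≤ 1) (hO : IsSparseAccess O A d) :
    ∃ UL UR : Matrix (Anc n × Word n) (Anc n × Word n) ℂ,
      UL ∈ Matrix.unitaryGroup (Anc n × Word n) ℂ ∧ UR ∈ Matrix.unitaryGroup (Anc n × Word n) ℂ ∧
      Implements O (leftCircuit N d) UL ∧ PreparesLeft A UL ∧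
      Implements O (rightCircuit N d) UR ∧ PreparesRight A UR ∧
      Implements O (blockCircuit N d) (ULᴴ * UR) ∧
      IsBlockEncoding 1 (n + 2) 0 (ancZero n) (ULᴴ * UR) (padded n (1 - A)) := by
  have hne (r : Fin N) : A r r ≠ 0 := fun h => by simpa [h] using hpos r
  obtain ⟨UL, hL, hLrows⟩ :=
    exists_preparesRows hN hd hA hpos hdom hle hO norm_amplitude_sqrt_conj
  obtain ⟨V, hV, hVrows⟩ :=
    exists_preparesRows hN hd hA hpos hdom hle hO norm_amplitude_conj_sqrt
  have hR : Implements O (rightCircuit N d) (V.submatrix swapRegs id) := hV.append_swapCircuit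
  have hLR : Implements O (blockCircuit N d) (ULᴴ * V.submatrix swapRegs id) :=
    hR.append (hL.adj (phaseFree_rowCircuit N d .sqrt .conj))
  refine ⟨UL, V.submatrix swapRegs id, hL.mem_unitaryGroup, hR.mem_unitaryGroup, hL,
    preparesLeft_of_preparesRows hN hA hne hle hLrows, hR,
    preparesRight_of_preparesRows hN hA hne hle hVrows, hLR,
    isBlockEncoding_of_apply_eq hLR.mem_unitaryGroup fun i j => ?_⟩
  exact (hLrows.conjTranspose_mul_submatrix_swapRegs hVrows i j).trans
    (conj_rowState_mul_rowState hN (Matrix.isHermitian_one.sub hA) i j)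

end

end PDQLS

end

theorem mainTheorem6_general :
    ∃ C : ℕ, ∀ N d n : ℕ, 0 < N → d ≤ N → N ≤ 2 ^ n →
      ∃ cL cR c : PDQLS.Circuit n,
        (∀ c' ∈ [cL, cR, c], c'.queries ≤ C * d ∧ c'.gates ≤ C * d) ∧
        ∀ A : Matrix (Fin N) (Fin N) ℂ,
          A.IsHermitian → (∀ i, 0 < (A i i).re) → PDQLS.IsDiagDominant A →
          (∀ i, (A i i).re ≤ 1) →
          ∀ O : PDQLS.Oracle n, PDQLS.IsSparseAccess O A d →
            ∃ UL UR : Matrix (PDQLS.Anc n × PDQLS.Word n) (PDQLS.Anc n × PDQLS.Word n) ℂ,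
              UL ∈ Matrix.unitaryGroup (PDQLS.Anc n × PDQLS.Word n) ℂ ∧
              UR ∈ Matrix.unitaryGroup (PDQLS.Anc n × PDQLS.Word n) ℂ ∧
              PDQLS.Implements O cL UL ∧ PDQLS.PreparesLeft A UL ∧
              PDQLS.Implements O cR UR ∧ PDQLS.PreparesRight A UR ∧
              PDQLS.Implements O c (ULᴴ * UR) ∧
              PDQLS.IsBlockEncoding 1 (n + 2) 0 (PDQLS.ancZero n) (ULᴴ * UR)
                (PDQLS.padded n (1 - A)) := by
  refine ⟨628, fun N d n hN0 hdN hN => ?_⟩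
  have : NeZero N := ⟨hN0.ne'⟩
  rcases Nat.eq_zero_or_pos d with rfl | hd
  · refine ⟨[], [], [], by simp [PDQLS.Circuit.queries, PDQLS.Circuit.gates],
      fun A _ hpos _ _ O hO => ?_⟩
    have hne : A 0 0 ≠ 0 := fun h => by simpa [h] using hpos 0
    exact absurd (hO.pos_of_apply_ne_zero hne) (lt_irrefl 0)
  · exact ⟨PDQLS.leftCircuit N d, PDQLS.rightCircuit N d, PDQLS.blockCircuit N d,
      PDQLS.cost_le hd, fun A hA hpos hdom hle O hO =>
        PDQLS.exists_implements_circuits hN (hdN.trans hN) hA hpos hdom hle hO⟩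

theorem mainTheorem6 :
    ∃ C : ℕ, ∀ N d n : ℕ, 0 < N → d ≤ N → n = Nat.clog 2 N →
      ∃ cL cR c : PDQLS.Circuit n,
        (∀ c' ∈ [cL, cR, c], c'.queries ≤ C * d ∧ c'.gates ≤ C * d) ∧
        ∀ A : Matrix (Fin N) (Fin N) ℂ,
          A.PosDef → PDQLS.IsDiagDominant A → (∀ i, (A i i).re ≤ 1) → PDQLS.IsSparse d A →
          ∀ O : PDQLS.Oracle n, PDQLS.IsSparseAccess O A d →
            ∃ UL UR : Matrix (PDQLS.Anc n × PDQLS.Word n) (PDQLS.Anc n × PDQLS.Word n) ℂ,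
              UL ∈ Matrix.unitaryGroup (PDQLS.Anc n × PDQLS.Word n) ℂ ∧
              UR ∈ Matrix.unitaryGroup (PDQLS.Anc n × PDQLS.Word n) ℂ ∧
              PDQLS.Implements O cL UL ∧ PDQLS.PreparesLeft A UL ∧
              PDQLS.Implements O cR UR ∧ PDQLS.PreparesRight A UR ∧
              PDQLS.Implements O c (ULᴴ * UR) ∧
              PDQLS.IsBlockEncoding 1 (n + 2) 0 (PDQLS.ancZero n) (ULᴴ * UR)
                (PDQLS.padded n (1 - A)) := by
  obtain ⟨C, hC⟩ := mainTheorem6_general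
  refine ⟨C, fun N d n hN0 hdN hn => ?_⟩
  obtain ⟨cL, cR, c, hcost, h⟩ := hC N d n hN0 hdN (hn ▸ Nat.le_pow_clog one_lt_two N)
  exact ⟨cL, cR, c, hcost, fun A hA hdom hle _ =>
    h A hA.isHermitian (fun _ => (Complex.pos_iff.1 hA.diag_pos).1) hdom hle⟩
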